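/- Fix integers $d\ge 2$ and $d_{\hat A}\ge 2$ and a real number $p\in[0,1]$. Let $\mathcal S^d_{AB}(\omega)=F\omega F^\dagger$ be the unitary swap channel on two $d$-dimensional systems $A,B$, where $F=\sum_{i,j}|i\rangle\langle j|\otimes|j\rangle\langle i|$, and let $$W^{(p,d_{\hat A})}_{\hat A\hat B}=(1-p)\,\frac{2}{d_{\hat A}(d_{\hat A}+1)}\,\frac{I+F}{2}+p\,\frac{2}{d_{\hat A}(d_{\hat A}-1)}\,\frac{I-F}{2}$$ be the Werner state on two $d_{\hat A}$-dimensional systems $\hat A,\hat B$ (here $F$ is the swap operator of $\hat A\hat B$). For a state $\rho_{\hat A\hat B}$ let $$e_{\mathrm{LOCC}}(\mathcal S^d_{AB},\rho_{\hat A\hat B})=\inf_{\mathcal L}\tfrac12\big\|\mathcal S^d_{AB}-\mathcal L_{AB\hat A\hat B\to AB}(\,\cdot\,\otimes\rho_{\hat A\hat B})\big\|_\diamond ,$$ where the infimum is over all channels $\mathcal L$ that can be implemented by finitely many rounds of local operations and classical communication between Alice (input $A\hat A$, output $A$) and Bob (input $B\hat B$, output $B$). Let $e_{\mathrm{PPT}}(\mathcal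 S^d_{AB},\rho_{\hat A\hat B})$ be the same infimum taken over all completely-PPT-preserving channels, i.e. quantum channels $\mathcal P_{AB\hat A\hat B\to AB}$ such that $T_{B}\circ\mathcal P\circ T_{B\hat B}$ is completely positive, where $T$ denotes the (partial) transpose on the indicated systems. The diamond distance is $\|\mathcal N-\mathcal M\|_\diamond=\sup_{\rho_{RC}}\|(\mathrm{id}_R\otimes\mathcal N)(\rho_{RC})-(\mathrm{id}_R\otimes\mathcal M)(\rho_{RC})\|_1$, the supremum being over all finite-dimensional reference systems $R$ and all states $\rho_{RC}$ of $R$ and the channel input system $C$. Then $$e_{\mathrm{PPT}}\big(\mathcal S^d_{AB},W^{(p,d_{\hat A})}_{\hat A\hat B}\big)=\begin{cases}1-\dfrac1{d^2} & \text{if } p\le \tfrac12,\\[2mm] 1-\dfrac{4p-2+d_{\hat A}}{d^2\,d_{\hat A}} & \text{if } p>\tfrac12.\end{cases}$$ Moreover, if $p\le\frac12$, then $$e_{\mathrm{PPT}}\big(\mathcal S^d_{AB},W^{(p,d_{\hat A})}_{\hat A\hat B}\big)=e_{\mathrm{LOCC}}\big(\mathcal S^d_{AB},W^{(p,d_{\hat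 A})}_{\hat A\hat B}\big).$$ -/

import Mathlib

namespace BidirTeleport

noncomputable section

open scoped ComplexOrder MatrixOrder Matrix

/-! Systems are finite index types (with their standard basis), operators are complex matrices
indexed by the basis, and maps between operators ("superoperators") are `ℂ`-linear. -/

/-- Linear operators on the Hilbert space `ℂ^A`. -/
abbrev Op (A : Type) : Type := Matrix A A ℂ

/-- Linear maps from operators on system `A` to operators on system `B`. -/
abbrev SuperOp (A B : Type) : Type := Op A →ₗ[ℂ] Op B

/-- A quantum state: a positive semi-definite operator of trace one. -/
def IsState {A : Type} [Fintype A] (ρ : Op A) : Prop :=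
  ρ.PosSemidef ∧ ρ.trace = 1

/-- `E_{A → C} ⊗ id_B`. -/
def tensorId {A C : Type} (B : Type) (E : SuperOp A C) : SuperOp (A × B) (C × B) where
  toFun X := Matrix.of fun r s => E (Matrix.of fun a a' => X (a, r.2) (a', s.2)) r.1 s.1
  map_add' X Y := by
    ext r s
    exact congrFun (congrFun (E.map_add (Matrix.of fun a a' => X (a, r.2) (a', s.2))
      (Matrix.of fun a a' => Y (a, r.2) (a', s.2))) r.1) s.1
  map_smul' c X := by
    ext r s
    exact congrFun (congrFun (E.map_smul c
      (Matrix.of fun a a' => X (a, r.2) (a', s.2))) r.1) s.1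

/-- `id_A ⊗ F_{B → D}`. -/
def idTensor {B D : Type} (A : Type) (F : SuperOp B D) : SuperOp (A × B) (A × D) where
  toFun X := Matrix.of fun r s => F (Matrix.of fun b b' => X (r.1, b) (s.1, b')) r.2 s.2
  map_add' X Y := by
    ext r s
    exact congrFun (congrFun (F.map_add (Matrix.of fun b b' => X (r.1, b) (s.1, b'))
      (Matrix.of fun b b' => Y (r.1, b) (s.1, b'))) r.2) s.2
  map_smul' c X := by
    ext r s
    exact congrFun (congrFun (F.map_smul c
      (Matrix.of fun b b' => X (r.1, b) (s.1, b'))) r.2) s.2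

/-- Complete positivity: `id_R ⊗ Φ` preserves positive semi-definiteness for every
finite-dimensional reference system `R`. -/
def IsCompletelyPositive {A B : Type} (Φ : SuperOp A B) : Prop :=
  ∀ (n : ℕ) (X : Op (Fin n × A)), X.PosSemidef → (idTensor (Fin n) Φ X).PosSemidef

def IsTracePreserving {A B : Type} [Fintype A] [Fintype B] (Φ : SuperOp A B) : Prop :=
  ∀ X : Op A, (Φ X).trace = X.trace

/-- A quantum channel: a completely positive and trace-preserving map. -/
def IsChannel {A B : Type} [Fintype A] [Fintype B] (Φ : SuperOp A B) : Prop :=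
  IsCompletelyPositive Φ ∧ IsTracePreserving Φ

/-- A quantum instrument: completely positive maps that sum to a trace-preserving map. -/
def IsInstrument {ι A C : Type} [Fintype ι] [Fintype A] [Fintype C]
    (E : ι → SuperOp A C) : Prop :=
  (∀ i, IsCompletelyPositive (E i)) ∧ IsTracePreserving (∑ i, E i)

/-- Bipartite channels `AB → A'B'` implementable by (finitely many rounds of) local operations
and classical communication. Either nothing remains to be done, or one of the two parties
applies a finite quantum instrument to its system and announces the outcome `i` to the other
party, whereupon both continue with an LOCC protocol `L i` that may depend on `i`. -/
inductive IsLOCC {A' B' : Type} [Fintype A'] [Fintype B'] :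
    ∀ {A B : Type} [Fintype A] [Fintype B], SuperOp (A × B) (A' × B') → Prop
  | done : IsLOCC (LinearMap.id : SuperOp (A' × B') (A' × B'))
  | alice {A B C ι : Type} [Fintype A] [Fintype B] [Fintype C] [Fintype ι]
      (E : ι → SuperOp A C) (L : ι → SuperOp (C × B) (A' × B')) :
      IsInstrument E → (∀ i, IsLOCC (L i)) →
      IsLOCC (∑ i, L i ∘ₗ tensorId B (E i))
  | bob {A B C ι : Type} [Fintype A] [Fintype B] [Fintype C] [Fintype ι]
      (F : ι → SuperOp B C) (L : ι → SuperOp (A × C) (A' × B')) :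
      IsInstrument F → (∀ i, IsLOCC (L i)) →
      IsLOCC (∑ i, L i ∘ₗ idTensor A (F i))

/-- The partial transpose `T_B` on operators of the bipartite system `AB`. -/
def partialTranspose (A B : Type) : SuperOp (A × B) (A × B) where
  toFun X := Matrix.of fun r s => X (r.1, s.2) (s.1, r.2)
  map_add' _ _ := rfl
  map_smul' _ _ := rfl

/-- Completely positive-partial-transpose-preserving channels: channels `P` from `AB` to `A'B'`
such that `T_{B'} ∘ P ∘ T_B` is completely positive. -/
def IsCPPTP {A B A' B' : Type} [Fintype A] [Fintype B] [Fintype A'] [Fintype B']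
    (P : SuperOp (A × B) (A' × B')) : Prop :=
  IsChannel P ∧
    IsCompletelyPositive (partialTranspose A' B' ∘ₗ P ∘ₗ partialTranspose A B)

/-- The trace norm `‖X‖₁ = Tr |X|` with `|X| = √(X† X)`. -/
def traceNorm {A : Type} [Fintype A] [DecidableEq A] (X : Op A) : ℝ :=
  (CFC.abs X).trace.re

/-- The diamond distance `‖N - M‖_⋄`: the supremum of `‖N(ρ_RC) - M(ρ_RC)‖₁` over all
finite-dimensional reference systems `R` and all states `ρ_RC`. -/
def diamondDist {C D : Type} [Fintype C] [Fintype D] [DecidableEq D]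
    (N M : SuperOp C D) : ℝ :=
  sSup {x : ℝ | ∃ (n : ℕ) (ρ : Op (Fin n × C)), IsState ρ ∧
    x = traceNorm (idTensor (Fin n) N ρ - idTensor (Fin n) M ρ)}

/-- Adjoining a resource operator: `ω_{AB} ↦ ω_{AB} ⊗ ρ_{ÂB̂}`, with the systems regrouped so
that Alice holds `AÂ` and Bob holds `BB̂`. -/
def attach {A B Ah Bh : Type} (ρ : Op (Ah × Bh)) :
    SuperOp (A × B) ((A × Ah) × (B × Bh)) where
  toFun ω := Matrix.of fun r s =>
    ω (r.1.1, r.2.1) (s.1.1, s.2.1) * ρ (r.1.2, r.2.2) (s.1.2, s.2.2)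
  map_add' X Y := by
    ext r s
    simp [add_mul]
  map_smul' c X := by
    ext r s
    simp [mul_assoc]

/-- The simulation `ω_{AB} ↦ P(ω_{AB} ⊗ ρ_{ÂB̂})`. -/
def simulation {A B Ah Bh A' B' : Type} (P : SuperOp ((A × Ah) × (B × Bh)) (A' × B'))
    (ρ : Op (Ah × Bh)) : SuperOp (A × B) (A' × B') :=
  P ∘ₗ attach ρ

/-- `e_LOCC(N, ρ)`: the least normalized diamond distance between the bipartite channel `N` and
its simulations by LOCC channels assisted by the resource state `ρ`. -/
def errorLOCC {A B Ah Bh A' B' : Type} [Fintype A] [Fintype B] [Fintype Ah] [Fintype Bh]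
    [Fintype A'] [Fintype B'] [DecidableEq A'] [DecidableEq B']
    (N : SuperOp (A × B) (A' × B')) (ρ : Op (Ah × Bh)) : ℝ :=
  ⨅ L : {L : SuperOp ((A × Ah) × (B × Bh)) (A' × B') // IsLOCC L},
    1 / 2 * diamondDist N (simulation L.1 ρ)

/-- `e_PPT(N, ρ)`: the same with C-PPT-P channels in place of LOCC channels. -/
def errorPPT {A B Ah Bh A' B' : Type} [Fintype A] [Fintype B] [Fintype Ah] [Fintype Bh]
    [Fintype A'] [Fintype B'] [DecidableEq A'] [DecidableEq B']
    (N : SuperOp (A × B) (A' × B')) (ρ : Op (Ah × Bh)) : ℝ :=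
  ⨅ P : {P : SuperOp ((A × Ah) × (B × Bh)) (A' × B') // IsCPPTP P},
    1 / 2 * diamondDist N (simulation P.1 ρ)

/-- The unitary swap operator `F = ∑ i j, |i⟩⟨j| ⊗ |j⟩⟨i|`. -/
def swapOp (d : ℕ) : Op (Fin d × Fin d) :=
  ∑ i : Fin d, ∑ j : Fin d, Matrix.single (i, j) (j, i) 1

/-- The unitary swap channel `S^d(ρ) = F ρ F†`. -/
def swapChannel (d : ℕ) : SuperOp (Fin d × Fin d) (Fin d × Fin d) where
  toFun ρ := swapOp d * ρ * (swapOp d)ᴴ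
  map_add' X Y := by simp [mul_add, add_mul]
  map_smul' c X := by simp

/-- The projection `(I + F)/2` onto the symmetric subspace. -/
def symProj (d : ℕ) : Op (Fin d × Fin d) := (1 / 2 : ℂ) • (1 + swapOp d)

/-- The projection `(I - F)/2` onto the antisymmetric subspace. -/
def antisymProj (d : ℕ) : Op (Fin d × Fin d) := (1 / 2 : ℂ) • (1 - swapOp d)

/-- The Werner state of parameter `p` on two systems of dimension `d`. -/
def wernerState (p : ℝ) (d : ℕ) : Op (Fin d × Fin d) :=
  ((1 - (p : ℂ)) * (2 / ((d : ℂ) * ((d : ℂ) + 1)))) • symProj d +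
    ((p : ℂ) * (2 / ((d : ℂ) * ((d : ℂ) - 1)))) • antisymProj d

end

end BidirTeleport

namespace BidirTeleport

open scoped ComplexOrder MatrixOrder Matrix

/-! ### Positive semi-definite matrices and the trace norm -/

section PosSemidef

variable {m n : Type} [Fintype m] [Fintype n]

/-! Write `Γ` for the partial transpose on Bob's side and `Φ` for the maximally entangled
projection. The proof matches a lower bound, valid for every C-PPT-P simulation, with explicit
protocols.

Lower bound. Feeding half of a maximally entangled state into a simulation and testing for the pure
output of the ideal swap bounds the error below by one minus the entanglement fidelity. Applying `Γ`
to both Choi matrices in this fidelity turns that of the swap into a permutation matrix, and that of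
the simulation into the Choi matrix of the completely positive map `ptConj P` fed with `ρ^Γ`. A
permutation matrix is unitary, so its overlap with a positive matrix is at most the trace. Splitting
`ρ^Γ = Rp - Rm` gives error at least `1 - (tr Rp + tr Rm) / d²` (`one_sub_le_half_diamondDist`). For
the Werner state `ρ^Γ` is a combination of `1 - Φ` and `Φ`, and the `Φ` coefficient `(1 - 2p)/D`
changes sign at `p = 1/2`: this is the case split.

Upper bounds. A simulation of the form `f S + (1 - f) K`, with `S` the swap and `K` a channel, has
error at most `1 - f` (`diamondDist_le_of_mixture`). Measuring in the standard basis and exchanging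
outcomes is LOCC, and yields dephasing followed by swap, which contains `S` with weight `1/d²`. For
`p > 1/2`, `pptProtocol` measures an effect on the resource whose probability is the required `f`,
and applies `S` or a complementary channel accordingly. Its `Γ`-conjugate is an explicit positive
combination. LOCC maps are C-PPT-P (`IsLOCC.isCPPTP`), so the lower bound covers both errors. -/

theorem re_trace_mul_nonneg {A B : Matrix n n ℂ} (hA : A.PosSemidef) (hB : B.PosSemidef) :
    0 ≤ (A * B).trace.re := by
  classical
  obtain ⟨C, rfl⟩ := CStarAlgebra.nonneg_iff_eq_star_mul_self.mp hA.nonneg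
  rw [mul_assoc, Matrix.trace_mul_comm]
  exact (Complex.le_def.mp (hB.mul_mul_conjTranspose_same C).trace_nonneg).1

theorem posSemidef_of_isHermitian_of_mul_self {P : Matrix n n ℂ} (hP : P.IsHermitian)
    (h : P * P = P) : P.PosSemidef := by
  have := Matrix.posSemidef_conjTranspose_mul_self P
  rwa [hP.eq, h] at this

theorem posSemidef_one_sub_of_mul_self [DecidableEq n] {P : Matrix n n ℂ} (hP : P.IsHermitian)
    (h : P * P = P) : (1 - P).PosSemidef := by
  refine posSemidef_of_isHermitian_of_mul_self (Matrix.isHermitian_one.sub hP) ?_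
  rw [sub_mul, mul_sub, mul_sub, h]; simp

/-- Summing a positive semi-definite block matrix over its blocks preserves positivity. -/
theorem posSemidef_blockSum {Z : Matrix (m × n) (m × n) ℂ} (hZ : Z.PosSemidef) :
    (Matrix.of fun r s => ∑ x, ∑ y, Z (r, x) (s, y) : Matrix m m ℂ).PosSemidef := by
  classical
  -- The block sum is the compression of `Z` by the identity tensored with the all-ones vector.
  have h := hZ.conjTranspose_mul_mul_same
    (Matrix.of fun (p : m × n) (r : m) => if p.1 = r then (1 : ℂ) else 0)
  convert h using 1
  ext r s
  simp [Matrix.mul_apply, Fintype.sum_prod_type, apply_ite]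
  have key (f : m → n → ℂ) (r : m) :
      ∑ x, ∑ y, (if x = r then f x y else 0) = ∑ y, f r y := by
    rw [Finset.sum_comm]; simp
  simp only [key]
  exact Finset.sum_comm

/-- Testing positivity on the vectors `e_z ± e_w` bounds an off-diagonal entry by the two diagonal
ones; along a permutation each diagonal entry is then used twice. -/
theorem abs_re_sum_perm_le {A : Matrix n n ℂ} (hA : A.PosSemidef) (π : Equiv.Perm n) :
    |(∑ z, A z (π z)).re| ≤ A.trace.re := by
  classical
  have key : ∀ z w, |2 * (A z w).re| ≤ (A z z).re + (A w w).re := by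
    intro z w
    have h := (hA.submatrix (fun b : Bool => if b then z else w)).dotProduct_mulVec_nonneg
      (fun b => if b then 1 else -1)
    have h' := (hA.submatrix (fun b : Bool => if b then z else w)).dotProduct_mulVec_nonneg
      (fun _ => 1)
    have h1 : (A w z).re = (A z w).re := by
      rw [← hA.isHermitian.apply w z]; simp
    have h2 := (Complex.le_def.mp h).1
    have h2' := (Complex.le_def.mp h').1
    simp [dotProduct, Matrix.mulVec] at h2 h2'
    exact abs_le.mpr ⟨by linarith, by linarith⟩
  have h1 : (∑ z, (A (π z) (π z)).re) = ∑ z, (A z z).re :=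
    Equiv.sum_comp π fun z => (A z z).re
  have h2 := (Finset.abs_sum_le_sum_abs _ _).trans
    (Finset.sum_le_sum fun z (_ : z ∈ Finset.univ) => key z (π z))
  rw [Finset.sum_add_distrib, h1, ← Finset.mul_sum, abs_mul, abs_two] at h2
  simp only [Complex.re_sum, Matrix.trace, Matrix.diag]
  linarith

end PosSemidef

section TraceNorm

variable {A : Type} [Fintype A] [DecidableEq A]

theorem traceNorm_nonneg (X : Op A) : 0 ≤ traceNorm X :=
  (Complex.le_def.mp (Matrix.nonneg_iff_posSemidef.mp (CFC.abs_nonneg X)).trace_nonneg).1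

theorem traceNorm_sub_le {ρ σ : Op A} (hρ : ρ.PosSemidef) (hσ : σ.PosSemidef) :
    traceNorm (ρ - σ) ≤ ρ.trace.re + σ.trace.re := by
  set X := ρ - σ with hX
  have hXs : IsSelfAdjoint X := hρ.isHermitian.sub hσ.isHermitian
  have hc (f : ℝ → ℝ) : ContinuousOn f (spectrum ℝ X) :=
    (Matrix.finite_real_spectrum (A := X)).continuousOn f
  -- `U` is the sign of `X`: `tr |X| = tr (U ρ) - tr (U σ)`, and `-1 ≤ U ≤ 1` bounds each term.
  set f : ℝ → ℝ := fun x => if 0 ≤ x then 1 else -1 with hf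
  set U : Op A := cfc f X with hU
  have habs : CFC.abs X = U * X := by
    rw [CFC.abs_eq_cfc_norm X hXs]
    have hid : U * X = cfc f X * cfc (id : ℝ → ℝ) X := by rw [cfc_id ℝ X hXs]
    rw [hid, ← cfc_mul f id X (hc _) (hc _)]
    congr 1
    ext x
    by_cases h : 0 ≤ x
    · simp [hf, h, abs_of_nonneg h]
    · simp [hf, h, abs_of_neg (not_le.mp h)]
  have h1 : (1 - U).PosSemidef := by
    rw [← Matrix.nonneg_iff_posSemidef, hU, ← cfc_one ℝ X hXs, ← cfc_sub _ _ X (hc _) (hc _)]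
    refine cfc_nonneg fun x _ => ?_
    by_cases h : 0 ≤ x <;> simp [hf, h]
  have h2 : (1 + U).PosSemidef := by
    rw [← Matrix.nonneg_iff_posSemidef, hU, ← cfc_one ℝ X hXs, ← cfc_add X _ _ (hc _) (hc _)]
    refine cfc_nonneg fun x _ => ?_
    by_cases h : 0 ≤ x <;> simp [hf, h]
  have h3 := re_trace_mul_nonneg h1 hρ
  have h4 := re_trace_mul_nonneg h2 hσ
  rw [traceNorm, habs, hX, mul_sub]
  rw [sub_mul, one_mul] at h3
  rw [add_mul, one_mul] at h4
  simp only [Matrix.trace_sub, Matrix.trace_add, Complex.sub_re, Complex.add_re] at *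
  linarith

/-- Pair `|X| - X ≥ 0` with `P` and `|X| + X ≥ 0` with `1 - P`, and add; the trace of `X` drops out.
-/
theorem two_mul_re_trace_mul_le_traceNorm {X P : Op A} (hX : X.IsHermitian) (hX0 : X.trace = 0)
    (hP : P.IsHermitian) (hPP : P * P = P) : 2 * (P * X).trace.re ≤ traceNorm X := by
  have hXs : IsSelfAdjoint X := hX
  have h1 : (CFC.abs X - X).PosSemidef := by
    rw [← Matrix.nonneg_iff_posSemidef, CFC.abs_sub_self X hXs]
    exact nsmul_nonneg (CFC.negPart_nonneg X) 2
  have h2 : (CFC.abs X + X).PosSemidef := by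
    rw [← Matrix.nonneg_iff_posSemidef, CFC.abs_add_self X hXs]
    exact nsmul_nonneg (CFC.posPart_nonneg X) 2
  have h3 := re_trace_mul_nonneg (posSemidef_of_isHermitian_of_mul_self hP hPP) h1
  have h4 := re_trace_mul_nonneg (posSemidef_one_sub_of_mul_self hP hPP) h2
  have h5 : X.trace.re = 0 := by simp [hX0]
  rw [mul_sub] at h3
  rw [sub_mul, one_mul, mul_add] at h4
  rw [traceNorm]
  simp only [Matrix.trace_sub, Matrix.trace_add, Complex.sub_re, Complex.add_re] at *
  linarith

theorem traceNorm_smul (c : ℝ) (hc : 0 ≤ c) (X : Op A) :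
    traceNorm ((c : ℂ) • X) = c * traceNorm X := by
  rw [traceNorm, CFC.abs_smul]
  simp [traceNorm, Matrix.trace_smul, abs_of_nonneg hc]

end TraceNorm

/-! ### Completely positive maps -/

section CompletelyPositive

variable {A B C D : Type}

theorem IsCompletelyPositive.idTensor_posSemidef {R : Type} [Fintype R] {Φ : SuperOp A B}
    (hΦ : IsCompletelyPositive Φ) {X : Op (R × A)} (hX : X.PosSemidef) :
    (idTensor R Φ X).PosSemidef := by
  let e := Fintype.equivFin R
  exact (hΦ (Fintype.card R) (X.submatrix (Prod.map e.symm id) (Prod.map e.symm id))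
    (hX.submatrix _)).submatrix (Prod.map e id) |> fun h => by
      convert h using 1
      ext r s
      simp [idTensor]

theorem IsCompletelyPositive.comp {Φ : SuperOp A B} {Ψ : SuperOp B C}
    (hΨ : IsCompletelyPositive Ψ) (hΦ : IsCompletelyPositive Φ) :
    IsCompletelyPositive (Ψ ∘ₗ Φ) :=
  fun n X hX => hΨ n _ (hΦ n X hX)

theorem isCompletelyPositive_id : IsCompletelyPositive (LinearMap.id : SuperOp A A) :=
  fun _ _ hX => hX

theorem IsCompletelyPositive.add {Φ Ψ : SuperOp A B}
    (hΦ : IsCompletelyPositive Φ) (hΨ : IsCompletelyPositive Ψ) :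
    IsCompletelyPositive (Φ + Ψ) :=
  fun n X hX => (hΦ n X hX).add (hΨ n X hX)

theorem isCompletelyPositive_sum {ι : Type} [Fintype ι] {Φ : ι → SuperOp A B}
    (h : ∀ i, IsCompletelyPositive (Φ i)) : IsCompletelyPositive (∑ i, Φ i) := by
  intro n X hX
  have : idTensor (Fin n) (∑ i, Φ i) X = ∑ i, idTensor (Fin n) (Φ i) X := by
    ext r s
    simp [idTensor, LinearMap.sum_apply, Matrix.sum_apply]
  rw [this]
  exact Matrix.posSemidef_sum _ fun i _ => h i n X hX

theorem IsCompletelyPositive.smul {Φ : SuperOp A B} (hΦ : IsCompletelyPositive Φ) {c : ℝ}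
    (hc : 0 ≤ c) : IsCompletelyPositive ((c : ℂ) • Φ) :=
  fun n X hX => (hΦ n X hX).smul (Complex.zero_le_real.mpr hc)

theorem IsCompletelyPositive.idTensor {F : SuperOp B D} (hF : IsCompletelyPositive F)
    (A : Type) [Fintype A] : IsCompletelyPositive (idTensor A F) := by
  intro n X hX
  exact (hF.idTensor_posSemidef (R := Fin n × A)
    (hX.submatrix fun p : (Fin n × A) × B => (p.1.1, p.1.2, p.2))).submatrix
      fun p : Fin n × A × D => ((p.1, p.2.1), p.2.2)

theorem IsCompletelyPositive.tensorId {E : SuperOp A C} (hE : IsCompletelyPositive E)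
    (B : Type) [Fintype B] : IsCompletelyPositive (tensorId B E) := by
  intro n X hX
  exact (hE.idTensor_posSemidef (R := Fin n × B)
    (hX.submatrix fun p : (Fin n × B) × A => (p.1.1, p.2, p.1.2))).submatrix
      fun p : Fin n × C × B => ((p.1, p.2.2), p.2.1)

theorem isCompletelyPositive_of_hadamard {Φ : SuperOp A A} {M : Op A} (hM : M.PosSemidef)
    (h : ∀ X a b, Φ X a b = X a b * M a b) : IsCompletelyPositive Φ := by
  intro n X hX
  have e : idTensor (Fin n) Φ X = X ⊙ M.submatrix Prod.snd Prod.snd := by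
    ext r s
    simp [BidirTeleport.idTensor, h]
  rw [e]
  exact hX.hadamard (hM.submatrix Prod.snd)

/-- A map is completely positive if its Choi matrix is positive semi-definite. -/
theorem isCompletelyPositive_of_choi [Fintype A] [Fintype B] {Φ : SuperOp A B} {J : Op (A × B)}
    (hJ : J.PosSemidef)
    (h : ∀ X b b', Φ X b b' = ∑ a, ∑ a', X a a' * J (a, b) (a', b')) :
    IsCompletelyPositive Φ := by
  intro n X hX
  -- `Φ` is a Schur product with `J`, positive by the Schur product theorem, followed by a block
  -- sum.
  convert posSemidef_blockSum
    ((hX.submatrix fun p : (Fin n × B) × A => (p.1.1, p.2)).hadamard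
      (hJ.submatrix fun p : (Fin n × B) × A => (p.2, p.1.2))) using 1
  ext r s
  simp [BidirTeleport.idTensor, h]

/-- The Choi matrix of a map. -/
def choi [DecidableEq A] (Φ : SuperOp A B) : Op (A × B) :=
  Matrix.of fun r s => Φ (Matrix.single r.1 s.1 1) r.2 s.2

theorem posSemidef_vecMulVec_choi [Fintype A] [DecidableEq A] :
    (Matrix.of fun r s : A × A => if r.1 = r.2 ∧ s.1 = s.2 then (1 : ℂ) else 0).PosSemidef := by
  convert Matrix.posSemidef_vecMulVec_self_star
    (fun r : A × A => if r.1 = r.2 then (1 : ℂ) else 0) using 1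
  ext r s
  simp [Matrix.vecMulVec_apply, ← ite_and, and_comm, apply_ite]

theorem IsCompletelyPositive.posSemidef_choi [Fintype A] [DecidableEq A] {Φ : SuperOp A B}
    (hΦ : IsCompletelyPositive Φ) : (choi Φ).PosSemidef := by
  convert hΦ.idTensor_posSemidef (posSemidef_vecMulVec_choi (A := A)) using 1
  ext r s
  simp only [choi, BidirTeleport.idTensor, Matrix.of_apply, LinearMap.coe_mk, AddHom.coe_mk]
  congr 2

/-- `X ↦ (Φ(Xᵀ))ᵀ`. -/
def transposeConj (Φ : SuperOp A B) : SuperOp A B where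
  toFun X := (Φ Xᵀ)ᵀ
  map_add' X Y := by simp
  map_smul' c X := by simp

/-- Transposing the reference as well, before and after, changes nothing, and the full transpose
preserves positivity. -/
theorem IsCompletelyPositive.transposeConj {Φ : SuperOp A B} (hΦ : IsCompletelyPositive Φ) :
    IsCompletelyPositive (transposeConj Φ) :=
  fun n X hX => (hΦ n Xᵀ hX.transpose).transpose

end CompletelyPositive

/-! ### Channels and the diamond distance -/

theorem trace_submatrix_equiv {m n : Type} [Fintype m] [Fintype n] (e : m ≃ n) (X : Op n) :
    (X.submatrix e e).trace = X.trace :=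
  Equiv.sum_comp e fun i => X i i

section Channels

variable {A B C D : Type} [Fintype A] [Fintype B] [Fintype C] [Fintype D]

theorem IsTracePreserving.idTensor {F : SuperOp B D} (hF : IsTracePreserving F)
    (A : Type) [Fintype A] : IsTracePreserving (idTensor A F) := by
  intro X
  simp only [Matrix.trace, Matrix.diag, Fintype.sum_prod_type]
  exact Finset.sum_congr rfl fun a _ => hF (Matrix.of fun b b' => X (a, b) (a, b'))

theorem IsTracePreserving.tensorId {E : SuperOp A C} (hE : IsTracePreserving E)
    (B : Type) [Fintype B] : IsTracePreserving (tensorId B E) := by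
  intro X
  simp only [Matrix.trace, Matrix.diag, Fintype.sum_prod_type_right]
  exact Finset.sum_congr rfl fun b _ => hE (Matrix.of fun a a' => X (a, b) (a', b))

theorem IsTracePreserving.comp {Φ : SuperOp A B} {Ψ : SuperOp B C}
    (hΨ : IsTracePreserving Ψ) (hΦ : IsTracePreserving Φ) : IsTracePreserving (Ψ ∘ₗ Φ) :=
  fun X => (hΨ _).trans (hΦ X)

theorem IsChannel.comp {Φ : SuperOp A B} {Ψ : SuperOp B C}
    (hΨ : IsChannel Ψ) (hΦ : IsChannel Φ) : IsChannel (Ψ ∘ₗ Φ) :=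
  ⟨hΨ.1.comp hΦ.1, hΨ.2.comp hΦ.2⟩

theorem IsChannel.isState_idTensor {R : Type} [Fintype R] {Φ : SuperOp A B} (hΦ : IsChannel Φ)
    {ρ : Op (R × A)} (hρ : IsState ρ) : IsState (idTensor R Φ ρ) :=
  ⟨hΦ.1.idTensor_posSemidef hρ.1, (hΦ.2.idTensor R ρ).trans hρ.2⟩

variable [DecidableEq D]

theorem diamondDist_nonneg (N M : SuperOp C D) : 0 ≤ diamondDist N M := by
  refine Real.sSup_nonneg ?_
  rintro x ⟨n, ρ, -, rfl⟩
  exact traceNorm_nonneg _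

theorem traceNorm_sub_le_two {ρ σ : Op D} (hρ : IsState ρ) (hσ : IsState σ) :
    traceNorm (ρ - σ) ≤ 2 := by
  refine (traceNorm_sub_le hρ.1 hσ.1).trans ?_
  rw [hρ.2, hσ.2]; norm_num

theorem traceNorm_le_diamondDist {N M : SuperOp C D} (hN : IsChannel N) (hM : IsChannel M)
    {n : ℕ} {ρ : Op (Fin n × C)} (hρ : IsState ρ) :
    traceNorm (idTensor (Fin n) N ρ - idTensor (Fin n) M ρ) ≤ diamondDist N M := by
  -- A real `sSup` is meaningful only for a bounded set; for channels the outputs are states, at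
  -- distance at most 2.
  refine le_csSup ⟨2, ?_⟩ ⟨n, ρ, hρ, rfl⟩
  rintro x ⟨k, σ, hσ, rfl⟩
  exact traceNorm_sub_le_two (hN.isState_idTensor hσ) (hM.isState_idTensor hσ)

/-- A convex decomposition of `M` containing `N` with weight `f` bounds the diamond distance. -/
theorem diamondDist_le_of_mixture {N M K : SuperOp C D} (hN : IsChannel N) (hK : IsChannel K)
    {f : ℝ} (hf : f ≤ 1) (hM : M = (f : ℂ) • N + ((1 - f : ℝ) : ℂ) • K) :
    diamondDist N M ≤ 2 * (1 - f) := by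
  refine Real.sSup_le ?_ (by linarith)
  rintro x ⟨n, ρ, hρ, rfl⟩
  have e : idTensor (Fin n) N ρ - idTensor (Fin n) M ρ
      = ((1 - f : ℝ) : ℂ) • (idTensor (Fin n) N ρ - idTensor (Fin n) K ρ) := by
    subst hM
    ext r s
    simp [idTensor]
    ring
  rw [e, traceNorm_smul _ (by linarith)]
  have := traceNorm_sub_le_two (hN.isState_idTensor hρ) (hK.isState_idTensor hρ)
  nlinarith

/-- Any projection yields a lower bound on the diamond distance. -/
theorem two_mul_re_trace_le_diamondDist {R : Type} [Fintype R] {N M : SuperOp C D}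
    (hN : IsChannel N) (hM : IsChannel M) {ρ : Op (R × C)} (hρ : IsState ρ) {P : Op (R × D)}
    (hP : P.IsHermitian) (hPP : P * P = P) :
    2 * (P * (idTensor R N ρ - idTensor R M ρ)).trace.re ≤ diamondDist N M := by
  classical
  let e := Fintype.equivFin R
  let eC : Fin (Fintype.card R) × C ≃ R × C := e.symm.prodCongr (Equiv.refl C)
  let eD : Fin (Fintype.card R) × D ≃ R × D := e.symm.prodCongr (Equiv.refl D)
  have hρ' : IsState (ρ.submatrix eC eC) :=
    ⟨hρ.1.submatrix _, (trace_submatrix_equiv eC ρ).trans hρ.2⟩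
  have h1 := hN.isState_idTensor hρ'
  have h2 := hM.isState_idTensor hρ'
  have h3 := two_mul_re_trace_mul_le_traceNorm
    (X := idTensor _ N (ρ.submatrix eC eC) - idTensor _ M (ρ.submatrix eC eC))
    (P := P.submatrix eD eD) (h1.1.isHermitian.sub h2.1.isHermitian)
    (by rw [Matrix.trace_sub, h1.2, h2.2, sub_self]) (hP.submatrix _)
    (by rw [Matrix.submatrix_mul_equiv, hPP])
  have h4 : idTensor _ N (ρ.submatrix eC eC) - idTensor _ M (ρ.submatrix eC eC)
      = (idTensor R N ρ - idTensor R M ρ).submatrix eD eD := rfl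
  refine le_trans (le_of_eq ?_) (h3.trans (traceNorm_le_diamondDist hN hM hρ'))
  rw [h4, Matrix.submatrix_mul_equiv, trace_submatrix_equiv]

end Channels

/-! ### LOCC maps are completely PPT preserving -/

section LOCC

variable {A B A' B' : Type}

@[simp]
theorem partialTranspose_partialTranspose (X : Op (A × B)) :
    partialTranspose A B (partialTranspose A B X) = X := rfl

/-- `T_{B'} ∘ P ∘ T_B`. -/
def ptConj (P : SuperOp (A × B) (A' × B')) : SuperOp (A × B) (A' × B') :=
  partialTranspose A' B' ∘ₗ P ∘ₗ partialTranspose A B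

theorem ptConj_tensorId (B : Type) (E : SuperOp A A') :
    ptConj (tensorId B E) = tensorId B E := rfl

theorem ptConj_idTensor (A : Type) (F : SuperOp B B') :
    ptConj (idTensor A F) = idTensor A (transposeConj F) := rfl

theorem ptConj_comp {C D : Type} (Q : SuperOp (C × D) (A' × B')) (P : SuperOp (A × B) (C × D)) :
    ptConj (Q ∘ₗ P) = ptConj Q ∘ₗ ptConj P := rfl

theorem ptConj_sum {ι : Type} [Fintype ι] (P : ι → SuperOp (A × B) (A' × B')) :
    ptConj (∑ i, P i) = ∑ i, ptConj (P i) := by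
  ext1 X
  simp [ptConj, LinearMap.sum_apply, map_sum]

variable [Fintype A] [Fintype B] [Fintype A'] [Fintype B']

theorem isTracePreserving_partialTranspose : IsTracePreserving (partialTranspose A B) :=
  fun _ => rfl

/-- Induction on the rounds: conjugation by the partial transpose fixes Alice's local maps and turns
each of Bob's into its `transposeConj`, which is again completely positive. -/
theorem IsLOCC.isCPPTP {P : SuperOp (A × B) (A' × B')} (hP : IsLOCC P) : IsCPPTP P := by
  suffices h : IsChannel P ∧ IsCompletelyPositive (ptConj P) from h
  induction hP with
  | done => exact ⟨⟨isCompletelyPositive_id, fun _ => rfl⟩, isCompletelyPositive_id⟩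
  | @alice A B C ι _ _ _ _ E L hE _ ih =>
    refine ⟨⟨isCompletelyPositive_sum fun i => (ih i).1.1.comp ((hE.1 i).tensorId B), ?_⟩, ?_⟩
    · intro X
      have h1 := hE.2.tensorId B X
      have h2 : tensorId B (∑ i, E i) X = ∑ i, tensorId B (E i) X := by
        ext r s
        simp [tensorId, LinearMap.sum_apply, Matrix.sum_apply]
      rw [h2] at h1
      simp only [LinearMap.sum_apply, Matrix.trace_sum, LinearMap.comp_apply] at h1 ⊢
      rw [← h1]
      exact Finset.sum_congr rfl fun i _ => (ih i).1.2 _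
    · rw [ptConj_sum]
      refine isCompletelyPositive_sum fun i => ?_
      rw [ptConj_comp, ptConj_tensorId]
      exact (ih i).2.comp ((hE.1 i).tensorId B)
  | @bob A B C ι _ _ _ _ F L hF _ ih =>
    refine ⟨⟨isCompletelyPositive_sum fun i => (ih i).1.1.comp ((hF.1 i).idTensor A), ?_⟩, ?_⟩
    · intro X
      have h1 := hF.2.idTensor A X
      have h2 : idTensor A (∑ i, F i) X = ∑ i, idTensor A (F i) X := by
        ext r s
        simp [idTensor, LinearMap.sum_apply, Matrix.sum_apply]
      rw [h2] at h1
      simp only [LinearMap.sum_apply, Matrix.trace_sum, LinearMap.comp_apply] at h1 ⊢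
      rw [← h1]
      exact Finset.sum_congr rfl fun i _ => (ih i).1.2 _
    · rw [ptConj_sum]
      refine isCompletelyPositive_sum fun i => ?_
      rw [ptConj_comp, ptConj_idTensor]
      exact (ih i).2.comp ((hF.1 i).transposeConj.idTensor A)

end LOCC

/-! ### Attaching a resource -/

section Attach

variable {A B Ah Bh : Type}

theorem isCompletelyPositive_attach {ρ : Op (Ah × Bh)} (hρ : ρ.PosSemidef) :
    IsCompletelyPositive (attach (A := A) (B := B) ρ) := by
  intro n X hX
  exact (hX.submatrix fun p : Fin n × (A × Ah) × (B × Bh) => (p.1, p.2.1.1, p.2.2.1)).hadamard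
    (hρ.submatrix fun p : Fin n × (A × Ah) × (B × Bh) => (p.2.1.2, p.2.2.2))

theorem attach_sub (ρ σ : Op (Ah × Bh)) :
    attach (A := A) (B := B) (ρ - σ) = attach ρ - attach σ := by
  ext X r s
  simp [attach, mul_sub]

variable [Fintype A] [Fintype B] [Fintype Ah] [Fintype Bh]

theorem trace_attach (ρ : Op (Ah × Bh)) (X : Op (A × B)) :
    (attach ρ X).trace = X.trace * ρ.trace := by
  simp only [Matrix.trace, Matrix.diag, attach, LinearMap.coe_mk, AddHom.coe_mk, Matrix.of_apply,
    Fintype.sum_prod_type, Finset.sum_mul_sum]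

theorem isChannel_attach {ρ : Op (Ah × Bh)} (hρ : IsState ρ) :
    IsChannel (attach (A := A) (B := B) ρ) :=
  ⟨isCompletelyPositive_attach hρ.1, fun X => by rw [trace_attach, hρ.2, mul_one]⟩

end Attach

/-! ### The swap channel -/

section Swap

variable {d : ℕ}

theorem swapOp_apply (r s : Fin d × Fin d) : swapOp d r s = if r.swap = s then 1 else 0 := by
  obtain ⟨a, b⟩ := r
  obtain ⟨a', b'⟩ := s
  simp [swapOp, Matrix.sum_apply, Matrix.single_apply, ite_and]

theorem swapOp_mul_apply (X : Op (Fin d × Fin d)) (r s : Fin d × Fin d) :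
    (swapOp d * X) r s = X r.swap s := by
  simp [Matrix.mul_apply, swapOp_apply]

theorem isHermitian_swapOp : (swapOp d).IsHermitian := by
  ext r s
  simp only [Matrix.conjTranspose_apply, swapOp_apply, apply_ite star, star_one, star_zero]
  refine if_congr ⟨?_, ?_⟩ rfl rfl <;> rintro rfl <;> simp

theorem swapOp_mul_self : swapOp d * swapOp d = 1 := by
  ext r s
  simp [swapOp_mul_apply, swapOp_apply, Matrix.one_apply]

theorem trace_swapOp : (swapOp d).trace = d := by
  simp [Matrix.trace, swapOp_apply, Fintype.sum_prod_type, Prod.ext_iff, ite_and]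

theorem swapChannel_apply (X : Op (Fin d × Fin d)) (r s : Fin d × Fin d) :
    swapChannel d X r s = X r.swap s.swap := by
  have h : swapChannel d X = swapOp d * (X * swapOp d) := by
    simp [swapChannel, isHermitian_swapOp.eq, mul_assoc]
  have h2 : X * swapOp d = (swapOp d * Xᵀ)ᵀ := by
    rw [Matrix.transpose_mul, Matrix.transpose_transpose]
    congr 1
    ext i j
    simp only [Matrix.transpose_apply, swapOp_apply]
    refine if_congr ⟨?_, ?_⟩ rfl rfl <;> rintro rfl <;> simp
  rw [h, h2, swapOp_mul_apply, Matrix.transpose_apply, swapOp_mul_apply, Matrix.transpose_apply]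

theorem isChannel_swapChannel : IsChannel (swapChannel d) := by
  constructor
  · intro n X hX
    convert hX.submatrix fun p : Fin n × Fin d × Fin d => (p.1, p.2.swap) using 1
    ext r s
    simp [idTensor, swapChannel_apply]
  · intro X
    simp only [Matrix.trace, Matrix.diag, swapChannel_apply]
    exact Equiv.sum_comp (Equiv.prodComm _ _) fun r => X r r

theorem choi_swapChannel (r s : (Fin d × Fin d) × (Fin d × Fin d)) :
    choi (swapChannel d) r s = if r.1.swap = r.2 ∧ s.1.swap = s.2 then 1 else 0 := by
  simp only [choi, Matrix.of_apply, swapChannel_apply, Matrix.single_apply]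
  refine if_congr (and_congr ?_ ?_) rfl rfl <;>
    exact ⟨fun h => by simp [h], fun h => by simp [← h]⟩

/-- The Choi matrix has rank one with squared norm `d²`, so dividing by `d²` gives a projection. -/
theorem choi_swapChannel_mul_self :
    choi (swapChannel d) * choi (swapChannel d) = ((d : ℂ) * d) • choi (swapChannel d) := by
  ext r s
  simp only [Matrix.mul_apply, choi_swapChannel, Matrix.smul_apply,
    Fintype.sum_prod_type (α₁ := Fin d × Fin d), smul_eq_mul]
  by_cases h1 : r.1.swap = r.2 <;> by_cases h2 : s.1.swap = s.2 <;>
    simp [h1, h2, Finset.sum_ite_eq]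

/-- The diamond distance to the swap channel is bounded below by the entanglement infidelity. -/
theorem two_mul_one_sub_le_diamondDist (hd : 0 < d)
    {M : SuperOp (Fin d × Fin d) (Fin d × Fin d)} (hM : IsChannel M) :
    2 * (1 - 1 / (d : ℝ) ^ 4 * (∑ c, ∑ c', M (Matrix.single c c' 1) c.swap c'.swap).re)
      ≤ diamondDist (swapChannel d) M := by
  have hd0 : (d : ℂ) ≠ 0 := by exact_mod_cast hd.ne'
  set q : ℝ := 1 / (d : ℝ) ^ 2 with hq
  have hq0 : 0 ≤ q := by positivity
  have hqd : (q : ℂ) * ((d : ℂ) * d) = 1 := by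
    rw [hq]; push_cast; field_simp
  let φ : Op ((Fin d × Fin d) × (Fin d × Fin d)) :=
    Matrix.of fun r s => if r.1 = r.2 ∧ s.1 = s.2 then (1 : ℂ) else 0
  have hid (Φ : SuperOp (Fin d × Fin d) (Fin d × Fin d)) :
      idTensor _ Φ ((q : ℂ) • φ) = (q : ℂ) • choi Φ := by
    rw [map_smul]
    congr 1
  have hρ : IsState ((q : ℂ) • φ) := by
    refine ⟨posSemidef_vecMulVec_choi.smul (Complex.zero_le_real.mpr hq0), ?_⟩
    rw [Matrix.trace_smul, ← hqd, smul_eq_mul]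
    simp [φ, Matrix.trace, Fintype.sum_prod_type (α₁ := Fin d × Fin d)]
  have hS := isChannel_swapChannel (d := d)
  set P := (q : ℂ) • choi (swapChannel d) with hP
  -- `P` is both the swap's output on the maximally entangled input and the test projection.
  have hPst : IsState P := by rw [hP, ← hid]; exact hS.isState_idTensor hρ
  have hPP : P * P = P := by
    rw [hP, smul_mul_smul_comm, choi_swapChannel_mul_self, smul_smul, mul_assoc, hqd, mul_one]
  have htr : (choi (swapChannel d) * choi M).trace
      = ∑ c, ∑ c', M (Matrix.single c c' 1) c.swap c'.swap := by
    simp only [Matrix.trace, Matrix.diag, Matrix.mul_apply, choi_swapChannel,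
      Fintype.sum_prod_type (α₁ := Fin d × Fin d)]
    simp [ite_and]
    rw [Finset.sum_comm]
    rfl
  have key := two_mul_re_trace_le_diamondDist hS hM hρ hPst.1.isHermitian hPP
  have htr' : (P * (P - (q : ℂ) • choi M)).trace.re
      = 1 - q * q * (∑ c, ∑ c', M (Matrix.single c c' 1) c.swap c'.swap).re := by
    rw [mul_sub, hPP, Matrix.trace_sub, hPst.2, hP, smul_mul_smul_comm, Matrix.trace_smul, htr,
      smul_eq_mul, ← Complex.ofReal_mul, Complex.sub_re, Complex.re_ofReal_mul, Complex.one_re]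
  rw [hid, hid, ← hP, htr', hq] at key
  convert key using 4
  ring

/-- The negativity bound on the fidelity with the swap channel. -/
theorem re_sum_simulation_le {Ah Bh : Type} [Fintype Ah] [Fintype Bh]
    {P : SuperOp ((Fin d × Ah) × (Fin d × Bh)) (Fin d × Fin d)} (hP : IsCPPTP P)
    {ρ Rp Rm : Op (Ah × Bh)} (hRp : Rp.PosSemidef) (hRm : Rm.PosSemidef)
    (hR : partialTranspose Ah Bh ρ = Rp - Rm) :
    (∑ c, ∑ c', simulation P ρ (Matrix.single c c' 1) c.swap c'.swap).re
      ≤ (d : ℝ) ^ 2 * (Rp.trace.re + Rm.trace.re) := by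
  set Q := ptConj P with hQ
  have hQcp : IsCompletelyPositive Q := hP.2
  have hQtp : IsTracePreserving Q := fun X => (hP.1.2 (partialTranspose _ _ X))
  -- The Choi matrix of the partially transposed swap is the permutation matrix of this involution;
  -- see `choi_ptConj_swapChannel`.
  let π : Equiv.Perm ((Fin d × Fin d) × (Fin d × Fin d)) :=
    { toFun := fun z => (z.2.swap, z.1.swap)
      invFun := fun z => (z.2.swap, z.1.swap)
      left_inv := fun _ => rfl
      right_inv := fun _ => rfl }
  have hV (X : Op (Ah × Bh)) : ∑ c, ∑ c', simulation P (partialTranspose Ah Bh X)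
      (Matrix.single c c' 1) c.swap c'.swap = ∑ z, choi (Q ∘ₗ attach X) z (π z) := by
    have hpt (a b a' b' : Fin d) : partialTranspose (Fin d) (Fin d)
        (Matrix.single (a, b) (a', b') 1) = Matrix.single (a, b') (a', b) 1 := by
      ext r s
      change Matrix.single (a, b) (a', b') (1 : ℂ) (r.1, s.2) (s.1, r.2) = _
      simp only [Matrix.single_apply, Prod.ext_iff]
      grind
    rw [← Fintype.sum_prod_type']
    refine Fintype.sum_equiv
      { toFun := fun z => ((z.1.1, z.2.2), (z.1.2, z.2.1))
        invFun := fun z => ((z.1.1, z.2.1), (z.2.2, z.1.2))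
        left_inv := fun _ => rfl
        right_inv := fun _ => rfl } _ _ ?_
    rintro ⟨⟨a, b⟩, ⟨a', b'⟩⟩
    -- `ptConj` is an involution, and transposing `BB̂` acts separately on the input and on the
    -- resource.
    have h : simulation P (partialTranspose Ah Bh X) = ptConj (Q ∘ₗ attach X) := rfl
    rw [h, ptConj, LinearMap.comp_apply, LinearMap.comp_apply, hpt]
    rfl
  have hT (R : Op (Ah × Bh)) : (choi (Q ∘ₗ attach R)).trace = (d : ℂ) ^ 2 * R.trace := by
    have (c : Fin d × Fin d) : ∑ x, choi (Q ∘ₗ attach R) (c, x) (c, x) = R.trace := by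
      have h := (hQtp (attach R (Matrix.single c c 1))).trans (trace_attach R _)
      rwa [Matrix.trace_single_eq_same, one_mul] at h
    simp only [Matrix.trace, Matrix.diag, Fintype.sum_prod_type (α₁ := Fin d × Fin d), this]
    simp [pow_two]
  have hb {R : Op (Ah × Bh)} (hR : R.PosSemidef) (σ : Equiv.Perm _) :
      |(∑ z, choi (Q ∘ₗ attach R) z (σ z)).re| ≤ (d : ℝ) ^ 2 * R.trace.re := by
    refine (abs_re_sum_perm_le (hQcp.comp (isCompletelyPositive_attach hR)).posSemidef_choi σ).trans ?_
    rw [hT, ← Complex.ofReal_natCast, ← Complex.ofReal_pow, Complex.re_ofReal_mul]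
  have h1 := hb hRp π
  have h2 := hb hRm π
  have h3 := hV (partialTranspose Ah Bh ρ)
  rw [partialTranspose_partialTranspose, hR] at h3
  have h4 (z w) : choi (Q ∘ₗ attach (Rp - Rm)) z w
      = choi (Q ∘ₗ attach Rp) z w - choi (Q ∘ₗ attach Rm) z w := by
    simp [choi, attach_sub]
  rw [h3]
  simp only [h4, Finset.sum_sub_distrib, Complex.sub_re]
  linarith [(abs_le.mp h1).2, (abs_le.mp h2).1]

/-- The negativity bound on the error of simulating the swap channel. -/
theorem one_sub_le_half_diamondDist (hd : 0 < d) {Ah Bh : Type} [Fintype Ah] [Fintype Bh]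
    {P : SuperOp ((Fin d × Ah) × (Fin d × Bh)) (Fin d × Fin d)} (hP : IsCPPTP P)
    {ρ Rp Rm : Op (Ah × Bh)} (hρ : IsState ρ) (hRp : Rp.PosSemidef) (hRm : Rm.PosSemidef)
    (hR : partialTranspose Ah Bh ρ = Rp - Rm) :
    1 - (Rp.trace.re + Rm.trace.re) / (d : ℝ) ^ 2
      ≤ 1 / 2 * diamondDist (swapChannel d) (simulation P ρ) := by
  have h1 := two_mul_one_sub_le_diamondDist hd (hP.1.comp (isChannel_attach hρ))
  have h2 := mul_le_mul_of_nonneg_left (re_sum_simulation_le hP hRp hRm hR)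
    (by positivity : 0 ≤ 1 / (d : ℝ) ^ 4)
  have h3 : 1 / (d : ℝ) ^ 4 * ((d : ℝ) ^ 2 * (Rp.trace.re + Rm.trace.re))
      = (Rp.trace.re + Rm.trace.re) / (d : ℝ) ^ 2 := by
    have : (d : ℝ) ≠ 0 := by exact_mod_cast hd.ne'
    field_simp
  rw [h3] at h2
  unfold simulation at h2 ⊢
  linarith

end Swap

/-! ### The Werner state -/

section Werner

/-- The projection onto the maximally entangled vector. -/
noncomputable def maxEntangled (D : ℕ) : Op (Fin D × Fin D) :=
  Matrix.of fun r s => if r.1 = r.2 ∧ s.1 = s.2 then (1 / D : ℂ) else 0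

variable {D : ℕ}

theorem isHermitian_maxEntangled : (maxEntangled D).IsHermitian := by
  ext r s
  simp [maxEntangled, apply_ite star, and_comm]

theorem maxEntangled_mul_self (hD : D ≠ 0) : maxEntangled D * maxEntangled D = maxEntangled D := by
  have : (D : ℂ) ≠ 0 := by exact_mod_cast hD
  ext r s
  simp only [Matrix.mul_apply, maxEntangled, Fintype.sum_prod_type, Matrix.of_apply]
  by_cases h1 : r.1 = r.2 <;> by_cases h2 : s.1 = s.2 <;> simp [h1, h2, Finset.sum_ite_eq]
  field_simp

theorem trace_maxEntangled (hD : D ≠ 0) : (maxEntangled D).trace = 1 := by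
  have : (D : ℂ) ≠ 0 := by exact_mod_cast hD
  simp [Matrix.trace, maxEntangled, Fintype.sum_prod_type, this]

theorem partialTranspose_one :
    partialTranspose (Fin D) (Fin D) (1 : Op (Fin D × Fin D)) = 1 := by
  ext r s
  change (1 : Op (Fin D × Fin D)) (r.1, s.2) (s.1, r.2) = _
  simp only [Matrix.one_apply, Prod.ext_iff]
  grind

theorem partialTranspose_swapOp (hD : D ≠ 0) :
    partialTranspose (Fin D) (Fin D) (swapOp D) = (D : ℂ) • maxEntangled D := by
  have : (D : ℂ) ≠ 0 := by exact_mod_cast hD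
  ext r s
  change swapOp D (r.1, s.2) (s.1, r.2) = _
  simp only [swapOp_apply, maxEntangled, Prod.ext_iff, Matrix.smul_apply, Matrix.of_apply,
    Prod.fst_swap, Prod.snd_swap, smul_eq_mul, mul_ite, mul_zero, mul_one_div_cancel this]
  grind

/-- For a Hermitian involution, `1 + H = (1 + H)² / 2`. -/
theorem posSemidef_one_add_of_mul_self {n : Type} [Fintype n] [DecidableEq n] {H : Op n}
    (hH : H.IsHermitian) (h : H * H = 1) : (1 + H).PosSemidef := by
  have h1 := Matrix.posSemidef_conjTranspose_mul_self (1 + H)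
  rw [Matrix.conjTranspose_add, hH.eq, Matrix.conjTranspose_one, add_mul, mul_add, mul_add, h] at h1
  have h2 := h1.smul (Complex.zero_le_real.mpr (by norm_num : (0 : ℝ) ≤ 1 / 2))
  convert h2 using 1
  push_cast
  simp only [mul_one, one_mul]
  module

variable {p : ℝ}

theorem wernerState_eq (p : ℝ) (hD : 2 ≤ D) : wernerState p D =
    (((D - 1 + 2 * p) / (D * (D ^ 2 - 1)) : ℝ) : ℂ) • (1 : Op (Fin D × Fin D)) +
      ((((1 - 2 * p) * D - 1) / (D * (D ^ 2 - 1)) : ℝ) : ℂ) • swapOp D := by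
  have h0 : (D : ℂ) ≠ 0 := by exact_mod_cast (by omega : D ≠ 0)
  have h1 : (D : ℂ) - 1 ≠ 0 := sub_ne_zero.mpr (by exact_mod_cast (by omega : D ≠ 1))
  have h2 : (D : ℂ) + 1 ≠ 0 := by exact_mod_cast (by omega : D + 1 ≠ 0)
  have h3 : (D : ℂ) ^ 2 - 1 = (D - 1) * (D + 1) := by ring
  simp only [wernerState, symProj, antisymProj]
  push_cast
  rw [h3]
  match_scalars <;> (field_simp; ring)

theorem isState_wernerState (hD : 2 ≤ D) (hp0 : 0 ≤ p) (hp1 : p ≤ 1) :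
    IsState (wernerState p D) := by
  have hD' : (2 : ℝ) ≤ D := by exact_mod_cast hD
  constructor
  · have hs : (symProj D).PosSemidef := by
      have := (posSemidef_one_add_of_mul_self isHermitian_swapOp
        (swapOp_mul_self (d := D))).smul (Complex.zero_le_real.mpr (by norm_num : (0 : ℝ) ≤ 1 / 2))
      simpa [symProj] using this
    have ha : (antisymProj D).PosSemidef := by
      have := (posSemidef_one_add_of_mul_self (isHermitian_swapOp (d := D)).neg
        (by rw [neg_mul_neg, swapOp_mul_self])).smul
          (Complex.zero_le_real.mpr (by norm_num : (0 : ℝ) ≤ 1 / 2))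
      simpa [antisymProj, sub_eq_add_neg] using this
    have h1 : (0 : ℝ) ≤ (1 - p) * (2 / (D * (D + 1))) :=
      mul_nonneg (by linarith) (by positivity)
    have h2 : (0 : ℝ) ≤ p * (2 / (D * (D - 1))) :=
      mul_nonneg hp0 (div_nonneg zero_le_two (mul_nonneg (by linarith) (by linarith)))
    have := (hs.smul (Complex.zero_le_real.mpr h1)).add (ha.smul (Complex.zero_le_real.mpr h2))
    push_cast at this
    exact this
  · have h0 : (D : ℂ) ≠ 0 := by exact_mod_cast (by omega : D ≠ 0)
    have h1 : (D : ℂ) ^ 2 - 1 ≠ 0 := by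
      rw [sub_ne_zero]; exact_mod_cast (by nlinarith : D ^ 2 ≠ 1)
    rw [wernerState_eq p hD, Matrix.trace_add, Matrix.trace_smul, Matrix.trace_smul, trace_swapOp,
      Matrix.trace_one]
    simp
    field_simp
    ring

theorem partialTranspose_wernerState (p : ℝ) (hD : 2 ≤ D) :
    partialTranspose (Fin D) (Fin D) (wernerState p D) =
      (((D - 1 + 2 * p) / (D * (D ^ 2 - 1)) : ℝ) : ℂ) • (1 - maxEntangled D) +
      (((1 - 2 * p) / D : ℝ) : ℂ) • maxEntangled D := by
  have h0 : (D : ℂ) ≠ 0 := by exact_mod_cast (by omega : D ≠ 0)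
  have h1 : (D : ℂ) ^ 2 - 1 ≠ 0 := by
    rw [sub_ne_zero]; exact_mod_cast (by nlinarith : D ^ 2 ≠ 1)
  rw [wernerState_eq p hD, map_add, map_smul, map_smul, partialTranspose_one,
    partialTranspose_swapOp (by omega)]
  push_cast
  match_scalars <;> field_simp
  ring

theorem re_trace_smul_one_sub_maxEntangled (p : ℝ) (hD : 2 ≤ D) :
    ((((D - 1 + 2 * p) / (D * (D ^ 2 - 1)) : ℝ) : ℂ) • (1 - maxEntangled D)).trace.re
      = (D - 1 + 2 * p) / D := by
  have h0 : (D : ℝ) ≠ 0 := by exact_mod_cast (by omega : D ≠ 0)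
  have h1 : (D : ℝ) ^ 2 - 1 ≠ 0 := by
    rw [sub_ne_zero]; exact_mod_cast (by nlinarith : D ^ 2 ≠ 1)
  rw [Matrix.trace_smul, Matrix.trace_sub, trace_maxEntangled (by omega), smul_eq_mul,
    Complex.re_ofReal_mul, Matrix.trace_one]
  simp
  field_simp

theorem re_trace_smul_maxEntangled (c : ℝ) (hD : 2 ≤ D) :
    ((c : ℂ) • maxEntangled D).trace.re = c := by
  rw [Matrix.trace_smul, trace_maxEntangled (by omega)]; simp

theorem posSemidef_smul_one_sub_maxEntangled (hD : 2 ≤ D) (hp0 : 0 ≤ p) :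
    ((((D - 1 + 2 * p) / (D * (D ^ 2 - 1)) : ℝ) : ℂ) • (1 - maxEntangled D)).PosSemidef := by
  have hD' : (2 : ℝ) ≤ D := by exact_mod_cast hD
  exact (posSemidef_one_sub_of_mul_self isHermitian_maxEntangled
    (maxEntangled_mul_self (by omega))).smul
      (Complex.zero_le_real.mpr (div_nonneg (by linarith) (mul_nonneg (by linarith) (by nlinarith))))

theorem posSemidef_smul_maxEntangled (hD : 2 ≤ D) {c : ℝ} (hc : 0 ≤ c) :
    ((c : ℂ) • maxEntangled D).PosSemidef :=
  (posSemidef_of_isHermitian_of_mul_self isHermitian_maxEntangled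
    (maxEntangled_mul_self (by omega))).smul (Complex.zero_le_real.mpr hc)

variable {d : ℕ} {P : SuperOp ((Fin d × Fin D) × (Fin d × Fin D)) (Fin d × Fin d)}

/-- Here `ρ^Γ` is itself positive, so `Rm = 0` and `tr Rp = 1`. -/
theorem error_lower_bound_of_le_half (hd : 2 ≤ d) (hD : 2 ≤ D) (hp0 : 0 ≤ p) (hp : p ≤ 1 / 2)
    (hP : IsCPPTP P) : 1 - 1 / (d : ℝ) ^ 2
      ≤ 1 / 2 * diamondDist (swapChannel d) (simulation P (wernerState p D)) := by
  have h := one_sub_le_half_diamondDist (by omega) hP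
    (isState_wernerState hD hp0 (by linarith))
    ((posSemidef_smul_one_sub_maxEntangled hD hp0).add (posSemidef_smul_maxEntangled hD
      (c := (1 - 2 * p) / D) (div_nonneg (by linarith) (by positivity)))) Matrix.PosSemidef.zero
    (by rw [sub_zero, partialTranspose_wernerState p hD])
  have h0 : (D : ℝ) ≠ 0 := by exact_mod_cast (by omega : D ≠ 0)
  rw [Matrix.trace_add, Complex.add_re, re_trace_smul_one_sub_maxEntangled p hD,
    re_trace_smul_maxEntangled _ hD, Matrix.trace_zero, Complex.zero_re] at h
  convert h using 3
  field_simp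
  ring

/-- The `Φ` part is now negative: `tr Rp + tr Rm = (D - 1 + 2p)/D + (2p - 1)/D`. -/
theorem error_lower_bound_of_half_lt (hd : 2 ≤ d) (hD : 2 ≤ D) (hp0 : 1 / 2 < p) (hp : p ≤ 1)
    (hP : IsCPPTP P) : 1 - (4 * p - 2 + (D : ℝ)) / ((d : ℝ) ^ 2 * (D : ℝ))
      ≤ 1 / 2 * diamondDist (swapChannel d) (simulation P (wernerState p D)) := by
  have h := one_sub_le_half_diamondDist (by omega) hP
    (isState_wernerState hD (by linarith) hp)
    (posSemidef_smul_one_sub_maxEntangled hD (by linarith)) (posSemidef_smul_maxEntangled hD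
      (c := (2 * p - 1) / D) (div_nonneg (by linarith) (by positivity)))
    (by
      have : (1 - 2 * p) / D = -((2 * p - 1) / D) := by ring
      rw [partialTranspose_wernerState p hD, this, Complex.ofReal_neg, neg_smul,
        ← sub_eq_add_neg])
  have h0 : (D : ℝ) ≠ 0 := by exact_mod_cast (by omega : D ≠ 0)
  have h1 : (d : ℝ) ≠ 0 := by exact_mod_cast (by omega : d ≠ 0)
  rw [re_trace_smul_one_sub_maxEntangled p hD, re_trace_smul_maxEntangled _ hD] at h
  convert h using 2
  field_simp
  ring

end Werner

/-! ### An optimal completely PPT preserving protocol -/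

section PPT

theorem isCompletelyPositive_of_posSemidef_choi {A B : Type} [Fintype A] [DecidableEq A]
    [Fintype B] {Φ : SuperOp A B} (h : (choi Φ).PosSemidef) : IsCompletelyPositive Φ := by
  refine isCompletelyPositive_of_choi h fun X b b' => ?_
  conv_lhs => rw [Matrix.matrix_eq_sum_single X]
  simp only [map_sum, Matrix.sum_apply]
  refine Finset.sum_congr rfl fun a _ => Finset.sum_congr rfl fun a' _ => ?_
  have : Matrix.single a a' (X a a') = X a a' • Matrix.single a a' 1 := by
    rw [Matrix.smul_single, smul_eq_mul, mul_one]
  rw [this, map_smul]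
  rfl

/-- `X ↦ tr(X) I`. -/
def traceOne (C : Type) [Fintype C] [DecidableEq C] : SuperOp C C where
  toFun X := X.trace • (1 : Op C)
  map_add' X Y := by rw [Matrix.trace_add, add_smul]
  map_smul' c X := by rw [Matrix.trace_smul, smul_assoc]; rfl

theorem choi_traceOne (C : Type) [Fintype C] [DecidableEq C] : choi (traceOne C) = 1 := by
  ext ⟨a, b⟩ ⟨a', b'⟩
  simp only [choi, traceOne, LinearMap.coe_mk, AddHom.coe_mk, Matrix.of_apply, Matrix.smul_apply,
    Matrix.one_apply, Prod.mk.injEq, smul_eq_mul, mul_ite, mul_one, mul_zero, ite_and]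
  by_cases h : a = a'
  · subst h; simp
  · simp [Matrix.trace_single_eq_of_ne _ _ _ h, h]

variable {A B Ah Bh : Type} [Fintype Ah] [Fintype Bh]

/-- Measuring the effect `M` on the resource systems: `X ↦ Tr_{ÂB̂}(X (I ⊗ M))`. -/
def measureOp (M : Op (Ah × Bh)) : SuperOp ((A × Ah) × (B × Bh)) (A × B) where
  toFun X := Matrix.of fun r s => ∑ x, ∑ y,
    X ((r.1, x.1), (r.2, x.2)) ((s.1, y.1), (s.2, y.2)) * M y x
  map_add' X Y := by
    ext r s
    simp [add_mul, Finset.sum_add_distrib]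
  map_smul' c X := by
    ext r s
    simp [mul_assoc, Finset.mul_sum]

theorem measureOp_apply (M : Op (Ah × Bh)) (X : Op ((A × Ah) × (B × Bh))) (r s : A × B) :
    measureOp M X r s = ∑ x, ∑ y,
      X ((r.1, x.1), (r.2, x.2)) ((s.1, y.1), (s.2, y.2)) * M y x := rfl

theorem measureOp_add (M N : Op (Ah × Bh)) :
    measureOp (A := A) (B := B) (M + N) = measureOp M + measureOp N := by
  ext X r s
  simp [measureOp, mul_add, Finset.sum_add_distrib]

theorem measureOp_smul (c : ℂ) (M : Op (Ah × Bh)) :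
    measureOp (A := A) (B := B) (c • M) = c • measureOp M := by
  ext X r s
  simp only [measureOp_apply, LinearMap.smul_apply, Matrix.smul_apply, smul_eq_mul, Finset.mul_sum]
  refine Finset.sum_congr rfl fun x _ => Finset.sum_congr rfl fun y _ => ?_
  ring

theorem measureOp_attach (M ρ : Op (Ah × Bh)) :
    measureOp (A := A) (B := B) M ∘ₗ attach ρ = (ρ * M).trace • LinearMap.id := by
  ext X r s
  simp only [LinearMap.comp_apply, measureOp_apply, attach, LinearMap.coe_mk, AddHom.coe_mk,
    Matrix.of_apply, LinearMap.smul_apply, LinearMap.id_apply, Matrix.smul_apply, smul_eq_mul,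
    Matrix.trace, Matrix.diag, Matrix.mul_apply, Finset.sum_mul]
  refine Finset.sum_congr rfl fun x _ => Finset.sum_congr rfl fun y _ => ?_
  ring

theorem isCompletelyPositive_measureOp {M : Op (Ah × Bh)} (hM : M.PosSemidef) [Fintype A]
    [Fintype B] : IsCompletelyPositive (measureOp (A := A) (B := B) M) := by
  intro n X hX
  have h := posSemidef_blockSum
    ((hX.submatrix fun p : (Fin n × A × B) × (Ah × Bh) =>
        (p.1.1, (p.1.2.1, p.2.1), (p.1.2.2, p.2.2))).hadamard
      (hM.transpose.submatrix fun p : (Fin n × A × B) × (Ah × Bh) => p.2))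
  convert h using 1
  ext r s
  rfl

/-- The transposes on `B` cancel, and the one on `B̂` moves onto the effect under the trace. -/
theorem ptConj_measureOp (M : Op (Ah × Bh)) :
    ptConj (measureOp (A := A) (B := B) M) = measureOp (partialTranspose Ah Bh M) := by
  ext X r s
  change ∑ x : Ah × Bh, ∑ y : Ah × Bh,
      X ((r.1, x.1), (r.2, y.2)) ((s.1, y.1), (s.2, x.2)) * M y x
    = ∑ x : Ah × Bh, ∑ y : Ah × Bh,
      X ((r.1, x.1), (r.2, x.2)) ((s.1, y.1), (s.2, y.2)) * M (y.1, x.2) (x.1, y.2)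
  rw [← Fintype.sum_prod_type', ← Fintype.sum_prod_type']
  exact Fintype.sum_equiv
    { toFun := fun z => ((z.1.1, z.2.2), (z.2.1, z.1.2))
      invFun := fun z => ((z.1.1, z.2.2), (z.2.1, z.1.2))
      left_inv := fun _ => rfl
      right_inv := fun _ => rfl } _ _ fun _ => rfl

theorem isTracePreserving_measureOp_one [Fintype A] [Fintype B] [DecidableEq Ah]
    [DecidableEq Bh] : IsTracePreserving (measureOp (A := A) (B := B) (1 : Op (Ah × Bh))) := by
  intro X
  simp only [Matrix.trace, Matrix.diag, measureOp_apply, Matrix.one_apply, mul_ite, mul_one,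
    mul_zero, Finset.sum_ite_eq', Finset.mem_univ, if_true]
  rw [← Fintype.sum_prod_type']
  exact Fintype.sum_equiv (Equiv.prodProdProdComm A B Ah Bh) _ _ fun _ => rfl

/-- A map that applies one of two channels according to the outcome of a measurement. -/
theorem isChannel_conditional [Fintype A] [Fintype B] [DecidableEq Ah] [DecidableEq Bh]
    {C : Type} [Fintype C] {M : Op (Ah × Bh)} (hM : M.PosSemidef) (hM' : (1 - M).PosSemidef)
    {N K : SuperOp (A × B) C} (hN : IsChannel N) (hK : IsChannel K) :
    IsChannel (N ∘ₗ measureOp M + K ∘ₗ measureOp (1 - M)) := by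
  refine ⟨(hN.1.comp (isCompletelyPositive_measureOp hM)).add
    (hK.1.comp (isCompletelyPositive_measureOp hM')), fun X => ?_⟩
  rw [LinearMap.add_apply, Matrix.trace_add, LinearMap.comp_apply, LinearMap.comp_apply, hN.2,
    hK.2, ← Matrix.trace_add, ← LinearMap.add_apply, ← measureOp_add, add_sub_cancel,
    isTracePreserving_measureOp_one]

variable {d D : ℕ}

/-- The channel orthogonal to the swap channel that is covariant under local unitaries. -/
noncomputable def antiSwap (d : ℕ) : SuperOp (Fin d × Fin d) (Fin d × Fin d) :=
  ((1 / ((d : ℝ) ^ 4 - 1) : ℝ) : ℂ) • (((d : ℂ) ^ 2) • traceOne (Fin d × Fin d) - swapChannel d)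

theorem isChannel_antiSwap (hd : 2 ≤ d) : IsChannel (antiSwap d) := by
  have hd' : (2 : ℝ) ≤ d := by exact_mod_cast hd
  have hd4 : (0 : ℝ) < (d : ℝ) ^ 4 - 1 := by nlinarith [sq_nonneg ((d : ℝ) ^ 2 - 1)]
  have hd4' : (d : ℂ) ^ 4 - 1 ≠ 0 := by exact_mod_cast hd4.ne'
  have hd0 : (d : ℂ) ≠ 0 := by exact_mod_cast (by omega : d ≠ 0)
  constructor
  · refine IsCompletelyPositive.smul (isCompletelyPositive_of_posSemidef_choi ?_) (by positivity)
    set q : ℝ := 1 / (d : ℝ) ^ 2 with hq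
    have hqd : (q : ℂ) * ((d : ℂ) * d) = 1 := by
      rw [hq]; push_cast; field_simp
    have hH : ((q : ℂ) • choi (swapChannel d)).IsHermitian :=
      (isChannel_swapChannel.1.posSemidef_choi.smul
        (Complex.zero_le_real.mpr (by positivity))).isHermitian
    -- The Choi matrix of `d² tr(·) I - S` is `d²` times the complement of the projection `q • choi
    -- S`.
    have h := (posSemidef_one_sub_of_mul_self hH (by
      rw [smul_mul_smul_comm, choi_swapChannel_mul_self, smul_smul, mul_assoc, hqd, mul_one])).smul
        (Complex.zero_le_real.mpr (by positivity : 0 ≤ (d : ℝ) ^ 2))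
    convert h using 1
    have : choi ((d : ℂ) ^ 2 • traceOne (Fin d × Fin d) - swapChannel d)
        = (d : ℂ) ^ 2 • choi (traceOne _) - choi (swapChannel d) := rfl
    rw [this, choi_traceOne, hq]
    push_cast
    match_scalars <;> field_simp
  · intro X
    simp only [antiSwap, LinearMap.smul_apply, LinearMap.sub_apply, Matrix.trace_smul,
      Matrix.trace_sub, isChannel_swapChannel.2 X, traceOne, LinearMap.coe_mk, AddHom.coe_mk,
      Matrix.trace_one, smul_eq_mul]
    simp
    field_simp

theorem ptConj_traceOne : ptConj (traceOne (Fin d × Fin d)) = traceOne (Fin d × Fin d) := by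
  ext1 X
  have h : ptConj (traceOne (Fin d × Fin d)) X
      = partialTranspose _ _ ((partialTranspose _ _ X).trace • (1 : Op (Fin d × Fin d))) := rfl
  rw [h, map_smul, partialTranspose_one, isTracePreserving_partialTranspose]
  rfl

theorem choi_ptConj_swapChannel (r s : (Fin d × Fin d) × (Fin d × Fin d)) :
    choi (ptConj (swapChannel d)) r s = if (r.2.swap, r.1.swap) = s then 1 else 0 := by
  have h : choi (ptConj (swapChannel d)) r s
      = swapChannel d (partialTranspose _ _ (Matrix.single r.1 s.1 1)) (r.2.1, s.2.2)
        (s.2.1, r.2.2) := rfl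
  rw [h, swapChannel_apply]
  change Matrix.single r.1 s.1 (1 : ℂ) (s.2.2, s.2.1) (r.2.2, r.2.1) = _
  simp only [Matrix.single_apply, Prod.ext_iff, Prod.fst_swap, Prod.snd_swap]
  grind

theorem isHermitian_choi_ptConj_swapChannel : (choi (ptConj (swapChannel d))).IsHermitian := by
  ext r s
  simp only [Matrix.conjTranspose_apply, choi_ptConj_swapChannel, apply_ite star, star_one,
    star_zero]
  refine if_congr ⟨?_, ?_⟩ rfl rfl <;> rintro rfl <;> simp

theorem choi_ptConj_swapChannel_mul_self :
    choi (ptConj (swapChannel d)) * choi (ptConj (swapChannel d)) = 1 := by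
  ext r s
  simp only [Matrix.mul_apply, choi_ptConj_swapChannel, ite_mul, one_mul, zero_mul,
    Finset.sum_ite_eq, Finset.mem_univ, if_true, Prod.swap_swap, Prod.mk.eta, Matrix.one_apply]

theorem isCompletelyPositive_traceOne_add_ptConj :
    IsCompletelyPositive (traceOne (Fin d × Fin d) + ptConj (swapChannel d)) := by
  refine isCompletelyPositive_of_posSemidef_choi ?_
  have := posSemidef_one_add_of_mul_self (isHermitian_choi_ptConj_swapChannel (d := d))
    choi_ptConj_swapChannel_mul_self
  rw [← choi_traceOne] at this
  exact this

theorem isCompletelyPositive_traceOne_sub_ptConj :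
    IsCompletelyPositive (traceOne (Fin d × Fin d) - ptConj (swapChannel d)) := by
  refine isCompletelyPositive_of_posSemidef_choi ?_
  have := posSemidef_one_add_of_mul_self (isHermitian_choi_ptConj_swapChannel (d := d)).neg
    (by rw [neg_mul_neg, choi_ptConj_swapChannel_mul_self])
  rw [← choi_traceOne, ← sub_eq_add_neg] at this
  exact this

/-- The effect on the resource systems on which the protocol applies the swap channel. -/
noncomputable def swapEffect (d D : ℕ) : Op (Fin D × Fin D) :=
  ((1 / (d : ℝ) ^ 2 : ℝ) : ℂ) • (1 - ((2 / D : ℝ) : ℂ) • swapOp D)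

/-- A convex combination of `1 + F` and `1 - F`, with weights `(1 ± c)/2`. -/
theorem posSemidef_one_add_smul_swapOp {c : ℝ} (h1 : -1 ≤ c) (h2 : c ≤ 1) :
    (1 + (c : ℂ) • swapOp D).PosSemidef := by
  have ha := (posSemidef_one_add_of_mul_self (isHermitian_swapOp (d := D)) swapOp_mul_self).smul
    (Complex.zero_le_real.mpr (by linarith : 0 ≤ (1 + c) / 2))
  have hb := (posSemidef_one_add_of_mul_self (isHermitian_swapOp (d := D)).neg
    (by rw [neg_mul_neg, swapOp_mul_self])).smul
    (Complex.zero_le_real.mpr (by linarith : 0 ≤ (1 - c) / 2))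
  convert ha.add hb using 1
  push_cast
  match_scalars <;> ring

theorem posSemidef_swapEffect (hD : 2 ≤ D) : (swapEffect d D).PosSemidef := by
  have hD' : (2 : ℝ) ≤ D := by exact_mod_cast hD
  have h := posSemidef_one_add_smul_swapOp (D := D) (c := -(2 / D))
    (by rw [neg_le_neg_iff, div_le_one (by linarith)]; exact hD')
    (le_trans (neg_nonpos.mpr (by positivity)) zero_le_one)
  convert h.smul (Complex.zero_le_real.mpr (by positivity : 0 ≤ 1 / (d : ℝ) ^ 2)) using 1
  rw [swapEffect]
  push_cast
  match_scalars <;> ring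

theorem posSemidef_one_sub_swapEffect (hd : 2 ≤ d) (hD : 2 ≤ D) :
    (1 - swapEffect d D).PosSemidef := by
  have hD' : (2 : ℝ) ≤ D := by exact_mod_cast hD
  have hd' : (2 : ℝ) ≤ d := by exact_mod_cast hd
  have hd2 : (0 : ℝ) < (d : ℝ) ^ 2 - 1 := by nlinarith
  have hdc : (d : ℂ) ^ 2 - 1 ≠ 0 := by exact_mod_cast hd2.ne'
  have hd0 : (d : ℂ) ≠ 0 := by exact_mod_cast (by omega : d ≠ 0)
  have hD0 : (D : ℂ) ≠ 0 := by exact_mod_cast (by omega : D ≠ 0)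
  -- This `c` comes from factoring `(d² - 1)/d²` out of `1 - swapEffect d D`.
  have h := posSemidef_one_add_smul_swapOp (D := D) (c := 2 / (D * ((d : ℝ) ^ 2 - 1)))
    (le_trans (by norm_num) (by positivity : (0 : ℝ) ≤ _))
    (by rw [div_le_one (by positivity)]; nlinarith)
  convert h.smul (Complex.zero_le_real.mpr
    (by positivity : 0 ≤ ((d : ℝ) ^ 2 - 1) / (d : ℝ) ^ 2)) using 1
  rw [swapEffect]
  push_cast
  match_scalars <;> field_simp

theorem trace_mul_swapEffect {p : ℝ} (hd : 2 ≤ d) (hD : 2 ≤ D) :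
    (wernerState p D * swapEffect d D).trace
      = (((4 * p - 2 + D) / ((d : ℝ) ^ 2 * D) : ℝ) : ℂ) := by
  have hd0 : (d : ℂ) ≠ 0 := by exact_mod_cast (by omega : d ≠ 0)
  have hD0 : (D : ℂ) ≠ 0 := by exact_mod_cast (by omega : D ≠ 0)
  have h1 : (D : ℂ) ^ 2 - 1 ≠ 0 := by
    rw [sub_ne_zero]; exact_mod_cast (by nlinarith : D ^ 2 ≠ 1)
  rw [wernerState_eq p hD, swapEffect]
  simp only [mul_smul_comm, mul_sub, add_mul, smul_mul_assoc, swapOp_mul_self, mul_one, one_mul,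
    Matrix.trace_smul, Matrix.trace_sub, Matrix.trace_add, trace_swapOp, Matrix.trace_one,
    smul_eq_mul]
  simp
  field_simp
  ring

/-- The optimal completely PPT preserving protocol. -/
noncomputable def pptProtocol (d D : ℕ) :
    SuperOp ((Fin d × Fin D) × (Fin d × Fin D)) (Fin d × Fin d) :=
  swapChannel d ∘ₗ measureOp (swapEffect d D) + antiSwap d ∘ₗ measureOp (1 - swapEffect d D)

/-- Since `F^Γ = D Φ`, the coefficient `2/D` in the effect makes its partial transpose `((1 - Φ) -
Φ)/d²`. Collecting the `1 - Φ` and `Φ` parts leaves multiples of `tr(·) I ± S^Γ`, whose Choi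
matrices are `1 ± H` with `H` a Hermitian involution. -/
theorem ptConj_pptProtocol (hd : 2 ≤ d) (hD : 2 ≤ D) : ptConj (pptProtocol d D) =
    ((1 / ((d : ℝ) ^ 2 + 1) : ℝ) : ℂ) • ((traceOne (Fin d × Fin d) + ptConj (swapChannel d)) ∘ₗ
        measureOp (1 - maxEntangled D)) +
      ((1 / ((d : ℝ) ^ 2 - 1) : ℝ) : ℂ) • ((traceOne (Fin d × Fin d) - ptConj (swapChannel d)) ∘ₗ
        measureOp (maxEntangled D)) := by
  have hd' : (2 : ℝ) ≤ d := by exact_mod_cast hd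
  have hd2 : (d : ℝ) ^ 2 - 1 ≠ 0 := by nlinarith
  have hdm : (d : ℂ) ^ 2 - 1 ≠ 0 := by exact_mod_cast hd2
  have hdp : (d : ℂ) ^ 2 + 1 ≠ 0 := by
    exact_mod_cast (by positivity : d ^ 2 + 1 ≠ 0)
  have hd0 : (d : ℂ) ≠ 0 := by exact_mod_cast (by omega : d ≠ 0)
  have hD0 : (D : ℂ) ≠ 0 := by exact_mod_cast (by omega : D ≠ 0)
  have hM : partialTranspose _ _ (swapEffect d D)
      = (1 / (d : ℂ) ^ 2) • (1 - maxEntangled D) + (-(1 / (d : ℂ) ^ 2)) • maxEntangled D := by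
    rw [swapEffect, map_smul, map_sub, map_smul, partialTranspose_one,
      partialTranspose_swapOp (by omega)]
    push_cast
    match_scalars <;> field_simp
    ring
  have hM' : partialTranspose _ _ (1 - swapEffect d D)
      = (((d : ℂ) ^ 2 - 1) / (d : ℂ) ^ 2) • (1 - maxEntangled D)
        + (((d : ℂ) ^ 2 + 1) / (d : ℂ) ^ 2) • maxEntangled D := by
    rw [map_sub, hM, partialTranspose_one]
    match_scalars <;> field_simp
    ring
  have h1 : ptConj (pptProtocol d D)
      = ptConj (swapChannel d) ∘ₗ ptConj (measureOp (swapEffect d D))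
        + ptConj (antiSwap d) ∘ₗ ptConj (measureOp (1 - swapEffect d D)) := rfl
  have h2 : ptConj (antiSwap d) = ((1 / ((d : ℝ) ^ 4 - 1) : ℝ) : ℂ) •
      (((d : ℂ) ^ 2) • ptConj (traceOne (Fin d × Fin d)) - ptConj (swapChannel d)) := rfl
  have h4 : (d : ℂ) ^ 4 - 1 = ((d : ℂ) ^ 2 - 1) * ((d : ℂ) ^ 2 + 1) := by ring
  rw [h1, h2, ptConj_traceOne, ptConj_measureOp, ptConj_measureOp, hM, hM', measureOp_add,
    measureOp_add, measureOp_smul, measureOp_smul, measureOp_smul, measureOp_smul]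
  ext1 X
  simp only [LinearMap.add_apply, LinearMap.sub_apply, LinearMap.smul_apply, LinearMap.comp_apply,
    map_add, map_smul]
  push_cast
  rw [h4]
  match_scalars <;> field_simp <;> ring

theorem isCPPTP_pptProtocol (hd : 2 ≤ d) (hD : 2 ≤ D) : IsCPPTP (pptProtocol d D) := by
  refine ⟨isChannel_conditional (posSemidef_swapEffect hD) (posSemidef_one_sub_swapEffect hd hD)
    isChannel_swapChannel (isChannel_antiSwap hd), ?_⟩
  have hd' : (2 : ℝ) ≤ d := by exact_mod_cast hd
  change IsCompletelyPositive (ptConj (pptProtocol d D))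
  rw [ptConj_pptProtocol hd hD]
  refine IsCompletelyPositive.add ?_ ?_
  · exact (isCompletelyPositive_traceOne_add_ptConj.comp (isCompletelyPositive_measureOp
      (posSemidef_one_sub_of_mul_self isHermitian_maxEntangled
        (maxEntangled_mul_self (by omega))))).smul (by positivity)
  · exact (isCompletelyPositive_traceOne_sub_ptConj.comp (isCompletelyPositive_measureOp
      (posSemidef_of_isHermitian_of_mul_self isHermitian_maxEntangled
        (maxEntangled_mul_self (by omega))))).smul (one_div_nonneg.mpr (by nlinarith))

theorem diamondDist_pptProtocol_le {p : ℝ} (hp0 : 0 ≤ p) (hp1 : p ≤ 1) (hd : 2 ≤ d) (hD : 2 ≤ D) :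
    diamondDist (swapChannel d) (simulation (pptProtocol d D) (wernerState p D))
      ≤ 2 * (1 - (4 * p - 2 + D) / ((d : ℝ) ^ 2 * D)) := by
  have hD' : (2 : ℝ) ≤ D := by exact_mod_cast hD
  have hd' : (2 : ℝ) ≤ d := by exact_mod_cast hd
  refine diamondDist_le_of_mixture isChannel_swapChannel (isChannel_antiSwap hd) ?_ ?_
  · rw [div_le_one (by positivity)]
    nlinarith [mul_le_mul hd' hd' (by norm_num) (by linarith)]
  · have h : simulation (pptProtocol d D) (wernerState p D)
        = swapChannel d ∘ₗ (measureOp (swapEffect d D) ∘ₗ attach (wernerState p D))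
          + antiSwap d ∘ₗ (measureOp (1 - swapEffect d D) ∘ₗ attach (wernerState p D)) := rfl
    rw [h, measureOp_attach, measureOp_attach, mul_sub, mul_one, Matrix.trace_sub,
      (isState_wernerState hD hp0 hp1).2, trace_mul_swapEffect hd hD, LinearMap.comp_smul,
      LinearMap.comp_smul, LinearMap.comp_id, LinearMap.comp_id, Complex.ofReal_sub,
      Complex.ofReal_one]

end PPT

/-! ### Measuring and exchanging the outcomes -/

section MeasureExchange

variable {A C : Type} [Fintype A]

/-- Measuring the diagonal effect `g` and preparing `Y`: `X ↦ Tr(diag(g) X) Y`. -/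
def measurePrepare (g : A → ℂ) (Y : Op C) : SuperOp A C where
  toFun X := (∑ a, g a * X a a) • Y
  map_add' X X' := by simp [mul_add, Finset.sum_add_distrib, add_smul]
  map_smul' c X := by
    simp only [Matrix.smul_apply, smul_eq_mul, mul_left_comm _ c, ← Finset.mul_sum, mul_smul,
      RingHom.id_apply]

theorem measurePrepare_apply (g : A → ℂ) (Y : Op C) (X : Op A) :
    measurePrepare g Y X = (∑ a, g a * X a a) • Y := rfl

theorem isCompletelyPositive_measurePrepare [Fintype C] {g : A → ℂ} (hg : 0 ≤ g) {Y : Op C}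
    (hY : Y.PosSemidef) : IsCompletelyPositive (measurePrepare g Y) := by
  classical
  refine isCompletelyPositive_of_choi
    (((Matrix.PosSemidef.diagonal hg).submatrix (Prod.fst : A × C → A)).hadamard
      (hY.submatrix Prod.snd)) fun X b b' => ?_
  simp only [measurePrepare_apply, Matrix.smul_apply, smul_eq_mul, Finset.sum_mul,
    Matrix.hadamard_apply, Matrix.submatrix_apply, Matrix.diagonal_apply, ite_mul, zero_mul,
    mul_ite, mul_zero, Finset.sum_ite_eq, Finset.mem_univ, if_true]
  exact Finset.sum_congr rfl fun a _ => by ring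

theorem isInstrument_measurePrepare [Fintype C] {ι : Type} [Fintype ι] {g : ι → A → ℂ}
    (hg : ∀ i, 0 ≤ g i) (hg1 : ∀ a, ∑ i, g i a = 1) {Y : Op C} (hY : IsState Y) :
    IsInstrument fun i => measurePrepare (g i) Y := by
  refine ⟨fun i => isCompletelyPositive_measurePrepare (hg i) hY.1, fun X => ?_⟩
  simp only [LinearMap.sum_apply, Matrix.trace_sum, measurePrepare_apply, Matrix.trace_smul, hY.2,
    smul_eq_mul, mul_one]
  rw [Finset.sum_comm]
  simp only [← Finset.sum_mul, hg1, one_mul]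
  rfl

theorem isState_single [Fintype C] [DecidableEq C] (c : C) :
    IsState (Matrix.single c c (1 : ℂ)) := by
  refine ⟨?_, Matrix.trace_single_eq_same c 1⟩
  rw [← Matrix.diagonal_single]
  exact Matrix.PosSemidef.diagonal (Pi.single_nonneg.mpr zero_le_one)

variable {d D : ℕ}

/-- The indicator of the event that the first system is in the basis state `i`. -/
def firstIs (D : ℕ) (i : Fin d) : Fin d × Fin D → ℂ := fun a => if a.1 = i then 1 else 0

theorem isInstrument_firstIs [Fintype C] {Y : Op C} (hY : IsState Y) :
    IsInstrument fun i : Fin d => measurePrepare (firstIs D i) Y := by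
  refine isInstrument_measurePrepare (fun i a => ?_) (fun a => ?_) hY
  · unfold firstIs; split_ifs <;> simp
  · simp [firstIs]

/-- Both parties measure in the standard basis, announce the outcomes, and prepare the basis
state that the other one has found. -/
def exchangeProtocol (d D : ℕ) : SuperOp ((Fin d × Fin D) × (Fin d × Fin D)) (Fin d × Fin d) :=
  ∑ i : Fin d, (∑ j : Fin d, (∑ _k : Unit, LinearMap.id ∘ₗ
      tensorId (Fin d) (measurePrepare (fun _ : Unit => (1 : ℂ)) (Matrix.single j j 1))) ∘ₗ
    idTensor Unit (measurePrepare (firstIs D j) (Matrix.single i i 1))) ∘ₗ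
  tensorId (Fin d × Fin D) (measurePrepare (firstIs D i) (1 : Op Unit))

theorem isLOCC_exchangeProtocol : IsLOCC (exchangeProtocol d D) := by
  -- Alice needs a second turn, since her preparation awaits Bob's outcome; meanwhile she holds the
  -- trivial system `Unit`.
  refine IsLOCC.alice _ _ (isInstrument_firstIs ⟨Matrix.PosSemidef.one, by simp⟩) fun i => ?_
  refine IsLOCC.bob _ _ (isInstrument_firstIs (isState_single i)) fun j => ?_
  exact IsLOCC.alice _ _ (isInstrument_measurePrepare (fun _ _ => zero_le_one) (fun _ => by simp)
    (isState_single j)) fun _ => IsLOCC.done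

/-- Dephasing in the standard basis, followed by the swap channel. -/
theorem simulation_exchangeProtocol {ρ : Op (Fin D × Fin D)} (hρ : ρ.trace = 1)
    (X : Op (Fin d × Fin d)) (r s : Fin d × Fin d) :
    simulation (exchangeProtocol d D) ρ X r s = if r = s then X r.swap r.swap else 0 := by
  have key (i j : Fin d) : ∑ a : Fin d × Fin D, firstIs D j a * ∑ b : Fin d × Fin D,
      firstIs D i b * attach ρ X (b, a) (b, a) = X (i, j) (i, j) := by
    have hρ' : ∑ l : Fin D, ∑ k : Fin D, ρ (k, l) (k, l) = 1 := by
      rw [Finset.sum_comm, ← hρ, Matrix.trace, Fintype.sum_prod_type]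
      rfl
    have hY (a b : Fin d × Fin D) : attach ρ X (b, a) (b, a)
      = X (b.1, a.1) (b.1, a.1) * ρ (b.2, a.2) (b.2, a.2) := rfl
    rw [← mul_one (X (i, j) (i, j)), ← hρ']
    simp only [firstIs, hY, Fintype.sum_prod_type, ite_mul, one_mul, zero_mul,
      Finset.mul_sum]
    simp
  have h : simulation (exchangeProtocol d D) ρ X r s = ∑ i, ∑ j,
      (∑ a : Fin d × Fin D, firstIs D j a * ∑ b : Fin d × Fin D,
        firstIs D i b * attach ρ X (b, a) (b, a)) *
          Matrix.single i i (1 : ℂ) r.2 s.2 * Matrix.single j j (1 : ℂ) r.1 s.1 := by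
    simp [simulation, exchangeProtocol, Matrix.sum_apply, tensorId, idTensor,
      measurePrepare_apply]
  rw [h]
  simp only [key, Matrix.single_apply]
  obtain ⟨a, b⟩ := r
  obtain ⟨a', b'⟩ := s
  by_cases h1 : a = a' <;> by_cases h2 : b = b' <;> simp [h1, h2, ite_and]

/-- The channel with which the swap channel is mixed in the simulation above. -/
noncomputable def offDiagonal (C : Type) [Fintype C] [DecidableEq C] : SuperOp C C where
  toFun X := X ⊙ (((Fintype.card C / (Fintype.card C - 1) : ℝ) : ℂ) •
    (1 - Matrix.of fun _ _ => (1 / Fintype.card C : ℂ)))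
  map_add' _ _ := Matrix.add_hadamard _ _ _
  map_smul' _ _ := Matrix.smul_hadamard _ _ _

/-- With `n = card C`, the value `-1/(n - 1)` is what cancels the off-diagonal entries of `(1/n) id
+ (1 - 1/n) offDiagonal`, leaving complete dephasing. -/
theorem offDiagonal_apply {C : Type} [Fintype C] [DecidableEq C] (hC : 1 < Fintype.card C)
    (X : Op C) (a b : C) : offDiagonal C X a b =
      X a b * if a = b then 1 else -(1 / (Fintype.card C - 1) : ℂ) := by
  have h0 : (Fintype.card C : ℂ) ≠ 0 := by exact_mod_cast (by omega : Fintype.card C ≠ 0)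
  have h1 : (Fintype.card C : ℂ) - 1 ≠ 0 :=
    sub_ne_zero.mpr (by exact_mod_cast (by omega : Fintype.card C ≠ 1))
  simp only [offDiagonal, LinearMap.coe_mk, AddHom.coe_mk, Matrix.hadamard_apply,
    Matrix.smul_apply, Matrix.sub_apply, Matrix.one_apply, Matrix.of_apply, smul_eq_mul]
  push_cast
  split_ifs <;> field_simp
  ring

theorem isChannel_offDiagonal {C : Type} [Fintype C] [DecidableEq C] (hC : 1 < Fintype.card C) :
    IsChannel (offDiagonal C) := by
  have h0 : (Fintype.card C : ℂ) ≠ 0 := by exact_mod_cast (by omega : Fintype.card C ≠ 0)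
  have hC' : (1 : ℝ) < Fintype.card C := by exact_mod_cast hC
  constructor
  -- The multiplier is a positive multiple of the complement of the projection onto the uniform
  -- vector.
  · refine isCompletelyPositive_of_hadamard ((posSemidef_one_sub_of_mul_self ?_ ?_).smul
      (Complex.zero_le_real.mpr (div_nonneg (by linarith) (by linarith)))) fun X a b => rfl
    · ext a b
      simp
    · ext a b
      simp [Matrix.mul_apply]
      field_simp
  · intro X
    simp [Matrix.trace, offDiagonal_apply hC]

theorem diamondDist_exchangeProtocol_le (hd : 2 ≤ d) {ρ : Op (Fin D × Fin D)}
    (hρ : ρ.trace = 1) : diamondDist (swapChannel d) (simulation (exchangeProtocol d D) ρ)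
      ≤ 2 * (1 - 1 / (d : ℝ) ^ 2) := by
  have hd' : (2 : ℝ) ≤ d := by exact_mod_cast hd
  have hC : Fintype.card (Fin d × Fin d) = d * d := by simp
  have hC1 : 1 < Fintype.card (Fin d × Fin d) := by rw [hC]; nlinarith
  have hd0 : (d : ℂ) ≠ 0 := by exact_mod_cast (by omega : d ≠ 0)
  have hd1 : (d : ℂ) ^ 2 - 1 ≠ 0 := by
    rw [sub_ne_zero]; exact_mod_cast (by nlinarith : d ^ 2 ≠ 1)
  refine diamondDist_le_of_mixture isChannel_swapChannel
    (isChannel_swapChannel.comp (isChannel_offDiagonal hC1)) ?_ ?_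
  · rw [div_le_one (by positivity)]; nlinarith
  · ext1 X
    ext r s
    simp only [simulation_exchangeProtocol hρ, LinearMap.add_apply, LinearMap.smul_apply,
      Matrix.add_apply, Matrix.smul_apply, LinearMap.comp_apply, swapChannel_apply,
      offDiagonal_apply hC1, hC, smul_eq_mul, Prod.swap_inj]
    by_cases h : r = s
    · subst h
      simp only [if_true]
      push_cast
      ring
    · simp only [h, if_false]
      push_cast
      rw [← pow_two]
      field_simp
      ring

end MeasureExchange

/-! ### Evaluating the infima from a protocol and a matching bound -/

section Errors

variable {A B Ah Bh A' B' : Type} [Fintype A] [Fintype B] [Fintype Ah] [Fintype Bh]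
    [Fintype A'] [Fintype B'] [DecidableEq A'] [DecidableEq B']
    {N : SuperOp (A × B) (A' × B')} {ρ : Op (Ah × Bh)} {c : ℝ}

theorem errorPPT_eq {P : SuperOp ((A × Ah) × (B × Bh)) (A' × B')} (hP : IsCPPTP P)
    (h : diamondDist N (simulation P ρ) ≤ 2 * c)
    (hc : ∀ Q : SuperOp ((A × Ah) × (B × Bh)) (A' × B'), IsCPPTP Q →
      c ≤ 1 / 2 * diamondDist N (simulation Q ρ)) : errorPPT N ρ = c := by
  have : Nonempty {P : SuperOp ((A × Ah) × (B × Bh)) (A' × B') // IsCPPTP P} := ⟨⟨P, hP⟩⟩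
  refine le_antisymm ((ciInf_le ⟨0, ?_⟩ ⟨P, hP⟩).trans (by linarith)) (le_ciInf fun Q => hc _ Q.2)
  rintro x ⟨Q, rfl⟩
  exact mul_nonneg (by norm_num) (diamondDist_nonneg _ _)

/-- The bound is assumed over the larger C-PPT-P class, so the same lower bound serves both errors.
-/
theorem errorLOCC_eq {L : SuperOp ((A × Ah) × (B × Bh)) (A' × B')} (hL : IsLOCC L)
    (h : diamondDist N (simulation L ρ) ≤ 2 * c)
    (hc : ∀ Q : SuperOp ((A × Ah) × (B × Bh)) (A' × B'), IsCPPTP Q →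
      c ≤ 1 / 2 * diamondDist N (simulation Q ρ)) : errorLOCC N ρ = c := by
  have : Nonempty {P : SuperOp ((A × Ah) × (B × Bh)) (A' × B') // IsLOCC P} := ⟨⟨L, hL⟩⟩
  refine le_antisymm ((ciInf_le ⟨0, ?_⟩ ⟨L, hL⟩).trans (by linarith))
    (le_ciInf fun Q => hc _ Q.2.isCPPTP)
  rintro x ⟨Q, rfl⟩
  exact mul_nonneg (by norm_num) (diamondDist_nonneg _ _)

end Errors

end BidirTeleport

theorem mainTheorem6 (d dA : ℕ) (hd : 2 ≤ d) (hdA : 2 ≤ dA) (p : ℝ) (hp0 : 0 ≤ p) (hp1 : p ≤ 1) :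
    (p ≤ 1 / 2 →
      BidirTeleport.errorPPT (BidirTeleport.swapChannel d) (BidirTeleport.wernerState p dA)
        = 1 - 1 / (d : ℝ) ^ 2) ∧
    (1 / 2 < p →
      BidirTeleport.errorPPT (BidirTeleport.swapChannel d) (BidirTeleport.wernerState p dA)
        = 1 - (4 * p - 2 + (dA : ℝ)) / ((d : ℝ) ^ 2 * (dA : ℝ))) ∧
    (p ≤ 1 / 2 →
      BidirTeleport.errorPPT (BidirTeleport.swapChannel d) (BidirTeleport.wernerState p dA)
        = BidirTeleport.errorLOCC (BidirTeleport.swapChannel d)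
            (BidirTeleport.wernerState p dA)) := by
  have hL := BidirTeleport.isLOCC_exchangeProtocol (d := d) (D := dA)
  have hdist := BidirTeleport.diamondDist_exchangeProtocol_le hd
    (BidirTeleport.isState_wernerState hdA hp0 hp1).2
  -- The LOCC protocol already attains the C-PPT-P bound, which forces the two errors to agree.
  have hppt (hp : p ≤ 1 / 2) := BidirTeleport.errorPPT_eq hL.isCPPTP hdist
    fun Q hQ => BidirTeleport.error_lower_bound_of_le_half hd hdA hp0 hp hQ
  refine ⟨hppt, fun hp => ?_, fun hp => ?_⟩
  · exact BidirTeleport.errorPPT_eq (BidirTeleport.isCPPTP_pptProtocol hd hdA)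
      (BidirTeleport.diamondDist_pptProtocol_le hp0 hp1 hd hdA)
      fun Q hQ => BidirTeleport.error_lower_bound_of_half_lt hd hdA hp hp1 hQ
  · exact (hppt hp).trans (BidirTeleport.errorLOCC_eq hL hdist
      fun Q hQ => BidirTeleport.error_lower_bound_of_le_half hd hdA hp0 hp hQ).symm
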